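/- Let $a>0$, $c>0$, $\gamma>0$, $T_L>0$ and $T_R>0$ be real numbers. For an integer $N\ge 2$ let $B\in\mathbb{R}^{N\times N}$ be the symmetric tridiagonal matrix with all diagonal entries equal to $a+2c$ and all entries directly above and below the diagonal equal to $-c$, let $\Gamma=\operatorname{diag}(\gamma,0,\dots,0,\gamma)\in\mathbb{R}^{N\times N}$, and put $$M=\begin{bmatrix}\Gamma & -I\\ B & 0\end{bmatrix}\in\mathbb{R}^{2N\times 2N},\qquad \Pi_N=\operatorname{diag}(2T_L,1,\dots,1,2T_R,\,1,1,\dots,1,1)\in\mathbb{R}^{2N\times 2N},$$ where $2T_L$ is the first and $2T_R$ the $N$-th diagonal entry of $\Pi_N$ and all other diagonal entries are $1$. Then for every $N\ge 2$ the Lyapunov equation $$b_N M+M^T b_N=\Pi_N$$ has exactly one solution $b_N\in\mathbb{C}^{2N\times 2N}$. This solution is real, symmetric and positive definite; thus it has the form $$b_N=\begin{bmatrix}x_N & z_N\\ z_N^T & y_N\end{bmatrix}$$ with real $N\times N$ blocks, $x_N$ and $y_N$ symmetric. Moreover its spectral norm (the operator norm for the Euclidean norm) satisfies $\|b_N\|_2=\mathcal{O}(N^3)$: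 there is a constant $C$, depending only on $a,c,\gamma,T_L,T_R$ and not on $N$, such that $\|b_N\|_2\le C N^3$ for all $N\ge 2$. -/

import Mathlib

namespace OscillatorChain

/-- The symmetric tridiagonal matrix `B` with `a + 2c` on the diagonal and `-c` on the two
neighbouring diagonals: the force matrix of the homogeneous harmonic chain whose two end
particles are also attached to walls. -/
def forceMatrix (a c : ℝ) (N : ℕ) : Matrix (Fin N) (Fin N) ℝ :=
  Matrix.of fun i j =>
    if i = j then a + 2 * c
    else if i.val + 1 = j.val ∨ j.val + 1 = i.val then -c
    else 0

/-- The friction matrix `Γ = diag(γ, 0, …, 0, γ)`. -/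
def frictionMatrix (γ : ℝ) (N : ℕ) : Matrix (Fin N) (Fin N) ℝ :=
  Matrix.diagonal fun i => if i.val = 0 ∨ i.val + 1 = N then γ else 0

/-- The `2N × 2N` block matrix `M = [[Γ, -I], [B, 0]]`; the first block of coordinates are the
momenta, the second the positions. -/
def driftMatrix (a c γ : ℝ) (N : ℕ) : Matrix (Fin N ⊕ Fin N) (Fin N ⊕ Fin N) ℝ :=
  Matrix.fromBlocks (frictionMatrix γ N) (-1) (forceMatrix a c N) 0

/-- The `2N × 2N` diagonal matrix `Π_N = diag(2 T_L, 1, …, 1, 2 T_R, 1, …, 1)`, where `2 T_R` is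
the `N`-th diagonal entry. -/
def lyapunovRHS (T_L T_R : ℝ) (N : ℕ) : Matrix (Fin N ⊕ Fin N) (Fin N ⊕ Fin N) ℝ :=
  Matrix.diagonal (Sum.elim
    (fun i : Fin N => if i.val = 0 then 2 * T_L else if i.val + 1 = N then 2 * T_R else 1)
    (fun _ => 1))

/-- A complex matrix `b` solves the Lyapunov equation `b M + Mᵀ b = Π_N`. -/
def SolvesLyapunov (a c γ T_L T_R : ℝ) (N : ℕ)
    (b : Matrix (Fin N ⊕ Fin N) (Fin N ⊕ Fin N) ℂ) : Prop :=
  b * (driftMatrix a c γ N).map Complex.ofReal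
      + ((driftMatrix a c γ N).map Complex.ofReal).transpose * b
    = (lyapunovRHS T_L T_R N).map Complex.ofReal

/-- The spectral norm `‖b‖₂` of a complex square matrix: the operator norm of `v ↦ b v` for the
Euclidean norm. -/
noncomputable def matrixNormTwo {n : Type*} [Fintype n] [DecidableEq n] (b : Matrix n n ℂ) : ℝ :=
  ‖Matrix.toEuclideanCLM (n := n) (𝕜 := ℂ) b‖

end OscillatorChain

/-!
Write `x = (u, q)` and consider the flow `x' = -M x`, so that `u' = q - Γ u`, `q' = -B u`, and `u`
solves the damped lattice wave equation `u'' = -B u - Γ u'`. Along this flow a quadratic form with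
symmetric matrix `P` has derivative `-⟨x, (P M + Mᵀ P) x⟩`.

Everything follows from one Lyapunov matrix `P` that is positive definite, has size `O(N³)`, and
satisfies `P M + Mᵀ P ≥ Π_N` (`exists_supersolution`). The comparison principle
`posSemidef_of_lyapunov` says that, in the presence of such a `P`, the operator `Q ↦ Q M + Mᴴ Q`
reflects positive semidefiniteness. Hence it is injective, so bijective; its solution for
a real positive definite right-hand side is real and positive definite
(`exists_unique_lyapunov`); and the solution lies below `P` in the Loewner order, which bounds its
spectral norm by `O(N³)` (`matrixNormTwo_le_of_supersolution`).

The matrix `P` (`superMatrix`) is found by a multiplier argument. The energy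
`E(x) = |u|² + ⟨q, B⁻¹ q⟩` dissipates only at the two end sites: its derivative is
`-2γ (u₁² + u_N²)`. Since `M` and the flow commute, `E(M x)` and `E(M² x)` dissipate in the same
way the end entries of `M x` and `M² x`, and the equation of motion then also controls the entries
at the sites next to the ends (`endProj_neighbourSum_le`). To see the interior, let `D` be the
central difference, `X` the position, and `K = (X D + D X) / 2` the discrete virial multiplier.
Its commutator with the nearest-neighbour coupling is `D²` plus a boundary term of size `N`
(`neighbourSum_commutator_virial`), so the functional `⟨u', K u⟩`, itself of size `N`, decreases
at the rate `(c / 2) |D u|²` up to end-site terms of size `N`. The discrete Poincaré inequality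
`|u|² ≤ 2 N (u₁² + u_N²) + 2 N² |D u|²` (`dotProduct_self_le_poincare`) costs a factor `N²`, whence
the total `N³`: the form of `P` is `κ N³ (E(x) + E(M x) + E(M² x))` plus a multiple of
`N² ⟨u', K u⟩` and a small multiple of `-⟨u', u⟩`, which supplies the missing `|u'|²`.
-/

open Matrix

namespace OscillatorChain

/-! ### Lyapunov operators and comparison -/

section Lyapunov

open scoped ComplexOrder MatrixOrder

variable {n : Type*} [Fintype n]

theorem posSemidef_map_ofReal {A : Matrix n n ℝ} (hA : A.PosSemidef) :
    (A.map Complex.ofReal).PosSemidef := by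
  classical
  obtain ⟨R, rfl⟩ := CStarAlgebra.nonneg_iff_eq_star_mul_self.mp hA.nonneg
  have h : (star R * R).map Complex.ofReal
      = (R.map Complex.ofReal)ᴴ * R.map Complex.ofReal := by
    ext i j
    simp [Matrix.mul_apply, star_eq_conjTranspose]
  rw [h]
  exact posSemidef_conjTranspose_mul_self _

theorem posDef_map_ofReal {A : Matrix n n ℝ} (hA : A.PosDef) :
    (A.map Complex.ofReal).PosDef := by
  classical
  rw [(posSemidef_map_ofReal hA.posSemidef).posDef_iff_isUnit]
  exact hA.isUnit.map Complex.ofRealHom.mapMatrix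

theorem posDef_of_map_ofReal {A : Matrix n n ℝ} (hA : (A.map Complex.ofReal).PosDef) :
    A.PosDef := by
  refine .of_dotProduct_mulVec_pos ?_ fun x hx => ?_
  · have h := hA.isHermitian
    ext i j
    have := congrFun (congrFun h i) j
    simpa using this
  · have hx' : (fun i => (x i : ℂ)) ≠ 0 := fun h => hx <| funext fun i => by
      simpa using congrFun h i
    have h := hA.dotProduct_mulVec_pos hx'
    have e : star (fun i => (x i : ℂ)) ⬝ᵥ A.map Complex.ofReal *ᵥ (fun i => (x i : ℂ))
        = ((star x ⬝ᵥ A *ᵥ x : ℝ) : ℂ) := by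
      simp [dotProduct, mulVec]
    rw [e] at h
    exact_mod_cast h

theorem dotProduct_lyapunov_eq_zero {M P : Matrix n n ℂ} (hP : P.IsHermitian) {x : n → ℂ}
    (hx : P *ᵥ x = 0) : star x ⬝ᵥ (P * M + Mᴴ * P) *ᵥ x = 0 := by
  have h : star x ᵥ* P = 0 := by
    rw [← hP.eq, ← star_mulVec, hx, star_zero]
  rw [add_mulVec, ← mulVec_mulVec, ← mulVec_mulVec, hx, mulVec_zero, add_zero,
    dotProduct_mulVec, h, zero_dotProduct]

/-- Comparison principle for the Lyapunov operator `Q ↦ Q M + Mᴴ Q`: if it maps some positive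
definite matrix to a positive definite one, then it reflects positive semidefiniteness. With `s`
least such that `Q + s P` is positive semidefinite, `Q + s P` has a kernel vector, at which the
form of its image vanishes; for `s > 0` that form is positive. -/
theorem posSemidef_of_lyapunov {M P Q : Matrix n n ℂ} (hP : P.PosDef)
    (hLP : (P * M + Mᴴ * P).PosDef) (hQ : Q.IsHermitian)
    (hLQ : (Q * M + Mᴴ * Q).PosSemidef) : Q.PosSemidef := by
  rcases isEmpty_or_nonempty n with hn | hn
  · rw [Subsingleton.elim Q 0]
    exact .zero
  let q : Matrix n n ℂ → (n → ℂ) → ℝ := fun A x => (star x ⬝ᵥ A *ᵥ x).re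
  have hqc (A : Matrix n n ℂ) : Continuous (q A) := by
    simp only [q, dotProduct, mulVec]
    fun_prop
  have hqP {x : n → ℂ} (hx : x ≠ 0) : 0 < q P x := hP.re_dotProduct_pos hx
  have hsph {x : n → ℂ} (hx : x ∈ Metric.sphere (0 : n → ℂ) 1) : x ≠ 0 := by
    rintro rfl
    simp at hx
  obtain ⟨x₀, hx₀, hmax⟩ := (isCompact_sphere (0 : n → ℂ) 1).exists_isMaxOn
    (NormedSpace.sphere_nonempty.mpr zero_le_one) (f := fun x => -q Q x / q P x)
    ((hqc Q).neg.continuousOn.div (hqc P).continuousOn fun x hx => (hqP (hsph hx)).ne')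
  obtain ⟨s, hs⟩ : ∃ s, s = -q Q x₀ / q P x₀ := ⟨_, rfl⟩
  have hadd (x : n → ℂ) : q (Q + (s : ℂ) • P) x = q Q x + s * q P x := by
    simp [q, add_mulVec, smul_mulVec]
  have hsP : ((s : ℂ) • P).IsHermitian := hP.isHermitian.smul (by simp [IsSelfAdjoint])
  have hH : (Q + (s : ℂ) • P).IsHermitian := hQ.add hsP
  have hpsd : (Q + (s : ℂ) • P).PosSemidef := by
    refine .of_dotProduct_mulVec_nonneg hH fun x => ?_
    refine Complex.nonneg_iff.mpr ⟨?_, (hH.im_star_dotProduct_mulVec_self x).symm⟩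
    change 0 ≤ q _ x
    by_cases hx : x = 0
    · simp [hx, q]
    have hx' : 0 < ‖x‖ := norm_pos_iff.mpr hx
    have hscale (A : Matrix n n ℂ) : q A (((‖x‖ : ℂ)⁻¹) • x) = (‖x‖⁻¹) ^ 2 * q A x := by
      simp only [q, star_smul, mulVec_smul, dotProduct_smul, smul_dotProduct, smul_eq_mul]
      rw [← mul_assoc, show (‖x‖ : ℂ)⁻¹ * star ((‖x‖ : ℂ)⁻¹) = (((‖x‖⁻¹) ^ 2 : ℝ) : ℂ) by
        simp [sq], Complex.re_ofReal_mul]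
    have hmem : ((‖x‖ : ℂ)⁻¹) • x ∈ Metric.sphere (0 : n → ℂ) 1 := by
      simp [norm_smul, hx'.ne']
    have h := hmax hmem
    simp only [Set.mem_ofPred_eq, ← hs] at h
    rw [div_le_iff₀ (hqP (hsph hmem)), hscale, hscale] at h
    rw [hadd]
    have h2 : 0 < (‖x‖⁻¹) ^ 2 := by positivity
    nlinarith
  rcases le_or_gt s 0 with hs0 | hs0
  · have h := hpsd.add (hP.posSemidef.smul (a := ((-s : ℝ) : ℂ)) (by
      rw [Complex.zero_le_real]; linarith))
    simpa [add_assoc, ← add_smul] using h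
  · exfalso
    have hz : (Q + (s : ℂ) • P) *ᵥ x₀ = 0 := by
      rw [← hpsd.dotProduct_mulVec_zero_iff]
      refine Complex.ext ?_ (hH.im_star_dotProduct_mulVec_self x₀)
      change q _ x₀ = 0
      rw [hadd, hs, div_mul_cancel₀ _ (hqP (hsph hx₀)).ne', add_neg_cancel]
    have h0 := dotProduct_lyapunov_eq_zero (M := M) hH hz
    have h1 : (Q + (s : ℂ) • P) * M + Mᴴ * (Q + (s : ℂ) • P)
        = (Q * M + Mᴴ * Q) + (s : ℂ) • (P * M + Mᴴ * P) := by
      rw [add_mul, mul_add, smul_mul_assoc, mul_smul_comm, smul_add]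
      abel
    have h2 := (hLP.smul (a := (s : ℂ)) (by exact_mod_cast hs0)).posSemidef_add hLQ
    rw [← h1] at h2
    exact (h2.dotProduct_mulVec_pos (hsph hx₀)).ne' h0

/-- The operator `b ↦ b M + Mᴴ b`. -/
noncomputable def lyapunovMap (M : Matrix n n ℂ) : Matrix n n ℂ →ₗ[ℂ] Matrix n n ℂ :=
  LinearMap.mulRight ℂ M + LinearMap.mulLeft ℂ Mᴴ

@[simp]
theorem lyapunovMap_apply (M b : Matrix n n ℂ) : lyapunovMap M b = b * M + Mᴴ * b := rfl

theorem lyapunovMap_conjTranspose (M b : Matrix n n ℂ) :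
    lyapunovMap M bᴴ = (lyapunovMap M b)ᴴ := by
  simp [conjTranspose_mul, add_comm]

/-- A Hermitian solution of the homogeneous equation vanishes by the comparison principle applied
to it and its negative; a general one is split into Hermitian and skew-Hermitian parts. -/
theorem lyapunovMap_bijective {M P : Matrix n n ℂ} (hP : P.PosDef)
    (hLP : (P * M + Mᴴ * P).PosDef) : Function.Bijective (lyapunovMap M) := by
  have herm {Q : Matrix n n ℂ} (hQ : Q.IsHermitian) (h : lyapunovMap M Q = 0) : Q = 0 := by
    refine le_antisymm
      (neg_nonneg.mp (posSemidef_of_lyapunov hP hLP (Q := -Q) hQ.neg ?_).nonneg)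
      (posSemidef_of_lyapunov hP hLP hQ ?_).nonneg
    · rw [← lyapunovMap_apply, map_neg, h, neg_zero]; exact .zero
    · rw [← lyapunovMap_apply, h]; exact .zero
  have inj : Function.Injective (lyapunovMap M) := by
    rw [← LinearMap.ker_eq_bot, LinearMap.ker_eq_bot']
    intro b hb
    have hb' : lyapunovMap M bᴴ = 0 := by rw [lyapunovMap_conjTranspose, hb, conjTranspose_zero]
    have h1 : b + bᴴ = 0 := herm (isHermitian_add_transpose_self b) (by
      rw [map_add, hb, hb', add_zero])
    have h2 : Complex.I • (b - bᴴ) = 0 := herm (by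
      simp [IsHermitian, conjTranspose_smul, ← smul_neg]) (by
      rw [map_smul, map_sub, hb, hb', sub_zero, smul_zero])
    have h3 : b - bᴴ = 0 := (smul_eq_zero.mp h2).resolve_left Complex.I_ne_zero
    have h4 : (2 : ℂ) • b = 0 := by
      rw [two_smul]
      calc b + b = (b + bᴴ) + (b - bᴴ) := by abel
        _ = 0 := by rw [h1, h3, add_zero]
    exact (smul_eq_zero.mp h4).resolve_left two_ne_zero
  exact ⟨inj, LinearMap.injective_iff_surjective.mp inj⟩

/-- The Lyapunov equation with real data has exactly one complex solution, and it is real and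
positive definite, as soon as `M` admits a real positive definite Lyapunov matrix `P`. -/
theorem exists_unique_lyapunov {M P R : Matrix n n ℝ} (hP : P.PosDef)
    (hLP : (P * M + Mᵀ * P).PosDef) (hR : R.PosDef) :
    ∃ b₀ : Matrix n n ℝ, b₀.PosDef ∧ ∀ b : Matrix n n ℂ,
      b * M.map Complex.ofReal + (M.map Complex.ofReal)ᵀ * b = R.map Complex.ofReal ↔
        b = b₀.map Complex.ofReal := by
  classical
  have hMt : (M.map Complex.ofReal)ᴴ = (M.map Complex.ofReal)ᵀ := by
    ext i j
    simp
  have hP' := posDef_map_ofReal hP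
  have hLP' : (P.map Complex.ofReal * M.map Complex.ofReal
      + (M.map Complex.ofReal)ᴴ * P.map Complex.ofReal).PosDef := by
    convert posDef_map_ofReal hLP using 1
    ext i j
    simp [Matrix.mul_apply]
  have hbij := lyapunovMap_bijective hP' hLP'
  obtain ⟨b, hb⟩ := hbij.2 (R.map Complex.ofReal)
  have hR' := posDef_map_ofReal hR
  have hherm : b.IsHermitian := hbij.1 (by
    rw [lyapunovMap_conjTranspose, hb, hR'.isHermitian.eq])
  have hreal : b.map star = b := hbij.1 (by
    rw [hb]
    have h := congrArg (fun A : Matrix n n ℂ => A.map star) hb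
    simp only [lyapunovMap_apply] at h ⊢
    refine Eq.trans ?_ (h.trans ?_)
    · ext i j
      simp [Matrix.mul_apply]
    · ext i j
      simp)
  have hb₀ : b = (b.map Complex.re).map Complex.ofReal := by
    ext i j
    have := congrFun (congrFun hreal i) j
    exact (Complex.conj_eq_iff_re.mp this).symm
  have hpsd : b.PosSemidef := posSemidef_of_lyapunov hP' hLP' hherm (by
    rw [← lyapunovMap_apply, hb]; exact hR'.posSemidef)
  have hpd : b.PosDef := by
    refine .of_dotProduct_mulVec_pos hherm fun x hx => ?_
    refine (hpsd.dotProduct_mulVec_nonneg x).lt_of_ne' fun h => ?_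
    have h0 := dotProduct_lyapunov_eq_zero (M := M.map Complex.ofReal) hherm
      ((hpsd.dotProduct_mulVec_zero_iff x).mp h)
    rw [← lyapunovMap_apply, hb] at h0
    exact (hR'.dotProduct_mulVec_pos hx).ne' h0
  refine ⟨b.map Complex.re, posDef_of_map_ofReal (hb₀ ▸ hpd), fun b' => ?_⟩
  rw [← hMt, ← lyapunovMap_apply, ← hb, hbij.1.eq_iff, ← hb₀]

/-- A positive semidefinite matrix below `C • 1` in the Loewner order has spectral norm at most
`C`. -/
theorem matrixNormTwo_le [DecidableEq n] {b : Matrix n n ℂ} {C : ℝ} (hC : 0 ≤ C)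
    (hb : b.PosSemidef) (hbC : ((C : ℂ) • (1 : Matrix n n ℂ) - b).PosSemidef) :
    matrixNormTwo b ≤ C := by
  have hsym : ((toEuclideanCLM (n := n) (𝕜 := ℂ) b : _ →L[ℂ] _) :
      EuclideanSpace ℂ n →ₗ[ℂ] EuclideanSpace ℂ n).IsSymmetric := by
    rw [coe_toEuclideanCLM_eq_toEuclideanLin]
    exact isSymmetric_toEuclideanLin_iff.mpr hb.isHermitian
  rw [matrixNormTwo, ContinuousLinearMap.norm_eq_iSup_rayleighQuotient _ hsym]
  refine ciSup_le fun x => ?_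
  have hre : (toEuclideanCLM (n := n) (𝕜 := ℂ) b).reApplyInnerSelf x
      = (star x.ofLp ⬝ᵥ b *ᵥ x.ofLp).re := by
    rw [ContinuousLinearMap.reApplyInnerSelf_apply, inner_re_symm,
      EuclideanSpace.inner_eq_star_dotProduct, dotProduct_comm]
    rfl
  have hnorm : (star x.ofLp ⬝ᵥ x.ofLp).re = ‖x‖ ^ 2 := by
    rw [dotProduct_comm, ← EuclideanSpace.inner_eq_star_dotProduct]
    exact inner_self_eq_norm_sq (𝕜 := ℂ) x
  have h1 := hb.re_dotProduct_nonneg x.ofLp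
  have h2 := hbC.re_dotProduct_nonneg x.ofLp
  simp only [sub_mulVec, smul_mulVec, one_mulVec, dotProduct_sub, dotProduct_smul, smul_eq_mul,
    map_sub, RCLike.re_to_complex, Complex.re_ofReal_mul, hnorm] at h1 h2
  rw [ContinuousLinearMap.rayleighQuotient, hre, abs_of_nonneg (by positivity)]
  exact div_le_of_le_mul₀ (by positivity) hC (by linarith)

/-- Any real supersolution `P ≤ C` of the Lyapunov equation bounds the spectral norm of the
solution by `C`. -/
theorem matrixNormTwo_le_of_supersolution [DecidableEq n] {M P R : Matrix n n ℝ} {C : ℝ}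
    (hC : 0 ≤ C) (hP : P.PosDef) (hR : R.PosDef) (hLP : (P * M + Mᵀ * P - R).PosSemidef)
    (hPC : (C • (1 : Matrix n n ℝ) - P).PosSemidef) {b : Matrix n n ℂ}
    (hb : b * M.map Complex.ofReal + (M.map Complex.ofReal)ᵀ * b = R.map Complex.ofReal) :
    matrixNormTwo b ≤ C := by
  have hLP0 : (P * M + Mᵀ * P).PosDef := by
    simpa using hR.posSemidef_add hLP
  obtain ⟨b₀, hb₀, huniq⟩ := exists_unique_lyapunov hP hLP0 hR
  obtain rfl := (huniq b).mp hb
  have hMt : (M.map Complex.ofReal)ᴴ = (M.map Complex.ofReal)ᵀ := by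
    ext i j
    simp
  have hL (A : Matrix n n ℝ) : A.map Complex.ofReal * M.map Complex.ofReal
      + (M.map Complex.ofReal)ᴴ * A.map Complex.ofReal
      = (A * M + Mᵀ * A).map Complex.ofReal := by
    ext i j
    simp [Matrix.mul_apply]
  have hdiff : ((P - b₀).map Complex.ofReal).PosSemidef := by
    refine posSemidef_of_lyapunov (M := M.map Complex.ofReal) (posDef_map_ofReal hP)
      (by rw [hL]; exact posDef_map_ofReal hLP0) ?_ ?_
    · ext i j
      have := congrFun (congrFun (hP.isHermitian.sub hb₀.isHermitian) i) j
      simp only [conjTranspose_apply, map_apply, Complex.star_def, Complex.conj_ofReal]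
      exact congrArg _ this
    · convert posSemidef_map_ofReal hLP using 1
      rw [← hMt, hL] at hb
      rw [hL]
      ext i j
      have h := congrFun (congrFun hb i) j
      simp only [map_apply, sub_mul, mul_sub, Matrix.add_apply, Matrix.sub_apply,
        Complex.ofReal_add, Complex.ofReal_sub] at h ⊢
      rw [← h]
      ring
  refine matrixNormTwo_le hC (posDef_map_ofReal hb₀).posSemidef ?_
  convert hdiff.add (posSemidef_map_ofReal hPC) using 1
  ext i j
  simp only [map_apply, Matrix.add_apply, Matrix.sub_apply, Matrix.smul_apply, smul_eq_mul,
    Matrix.one_apply, Complex.ofReal_sub, Complex.ofReal_mul, apply_ite Complex.ofReal,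
    Complex.ofReal_one, Complex.ofReal_zero]
  ring

end Lyapunov

/-! ### Lattice operators and the virial commutator -/

section Chain

variable {N : ℕ}

/-- The upper shift `(S u)ᵢ = uᵢ₊₁`, with the value `0` past the right end. -/
def shift (N : ℕ) : Matrix (Fin N) (Fin N) ℝ :=
  Matrix.of fun i j => if i.val + 1 = j.val then 1 else 0

/-- The sum of the two neighbours, `(A u)ᵢ = uᵢ₊₁ + uᵢ₋₁`. -/
def neighbourSum (N : ℕ) : Matrix (Fin N) (Fin N) ℝ := shift N + (shift N)ᵀ

/-- The central difference, `(D u)ᵢ = uᵢ₊₁ - uᵢ₋₁`. -/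
def centralDiff (N : ℕ) : Matrix (Fin N) (Fin N) ℝ := shift N - (shift N)ᵀ

/-- Multiplication by the position, measured from the midpoint of the chain. -/
noncomputable def position (N : ℕ) : Matrix (Fin N) (Fin N) ℝ :=
  diagonal fun i => (i : ℝ) - ((N : ℝ) - 1) / 2

/-- The virial multiplier `K = (X D + D X) / 2`, a discrete, antisymmetric `2 x ∂ₓ + 1`. -/
noncomputable def virial (N : ℕ) : Matrix (Fin N) (Fin N) ℝ :=
  (1 / 2 : ℝ) • (position N * centralDiff N + centralDiff N * position N)

/-- The projection onto the two end sites. -/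
def endProj (N : ℕ) : Matrix (Fin N) (Fin N) ℝ :=
  diagonal fun i => if i.val = 0 ∨ i.val + 1 = N then 1 else 0

theorem shift_mul_transpose (N : ℕ) :
    shift N * (shift N)ᵀ = 1 - diagonal fun i : Fin N => if i.val + 1 = N then 1 else 0 := by
  ext i j
  simp only [mul_apply, shift, transpose_apply, of_apply, Matrix.sub_apply, Matrix.one_apply,
    diagonal_apply]
  by_cases hi : i.val + 1 = N
  · rw [Finset.sum_eq_zero fun k _ => by rw [if_neg (by omega), zero_mul]]
    simp [hi]
  · rw [Finset.sum_eq_single ⟨i.val + 1, by omega⟩]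
    · by_cases hij : i = j
      · simp [hij, hij ▸ hi]
      · have : ¬ j.val + 1 = i.val + 1 := fun h => hij (Fin.ext (by omega))
        simp [hij] at *
        omega
    · intro k _ hk
      rw [if_neg (fun h => hk (Fin.ext h.symm)), zero_mul]
    · simp

theorem shift_transpose_mul (N : ℕ) :
    (shift N)ᵀ * shift N = 1 - diagonal fun i : Fin N => if i.val = 0 then 1 else 0 := by
  ext i j
  simp only [mul_apply, shift, transpose_apply, of_apply, Matrix.sub_apply, Matrix.one_apply,
    diagonal_apply]
  by_cases hi : i.val = 0
  · rw [Finset.sum_eq_zero fun k _ => by rw [if_neg (by omega), zero_mul]]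
    simp [hi]
  · rw [Finset.sum_eq_single ⟨i.val - 1, by omega⟩]
    · by_cases hij : i = j
      · subst hij
        simp [hi, Nat.sub_add_cancel (Nat.pos_of_ne_zero hi)]
      · have : ¬ i.val = j.val := fun h => hij (Fin.ext h)
        simp [hij]
        omega
    · intro k _ hk
      rw [if_neg (fun h => hk (Fin.ext (by simp; omega))), zero_mul]
    · simp

theorem transpose_neighbourSum (N : ℕ) : (neighbourSum N)ᵀ = neighbourSum N := by
  simp [neighbourSum, add_comm]

theorem transpose_centralDiff (N : ℕ) : (centralDiff N)ᵀ = -centralDiff N := by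
  simp [centralDiff]

theorem transpose_position (N : ℕ) : (position N)ᵀ = position N := diagonal_transpose _

theorem transpose_endProj (N : ℕ) : (endProj N)ᵀ = endProj N := diagonal_transpose _

theorem transpose_virial (N : ℕ) : (virial N)ᵀ = -virial N := by
  simp only [virial, transpose_smul, transpose_add, transpose_mul, transpose_centralDiff,
    transpose_position, neg_mul, mul_neg, ← smul_neg, neg_add]
  rw [add_comm]

theorem endProj_mul_self (N : ℕ) : endProj N * endProj N = endProj N := by
  simp [endProj, diagonal_mul_diagonal]

theorem frictionMatrix_eq (γ : ℝ) (N : ℕ) : frictionMatrix γ N = γ • endProj N := by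
  simp [frictionMatrix, endProj, ← diagonal_smul, diagonal_eq_diagonal_iff]

theorem forceMatrix_eq (a c : ℝ) (N : ℕ) :
    forceMatrix a c N = (a + 2 * c) • (1 : Matrix (Fin N) (Fin N) ℝ) - c • neighbourSum N := by
  ext i j
  simp only [forceMatrix, neighbourSum, shift, of_apply, Matrix.sub_apply, Matrix.smul_apply,
    Matrix.add_apply, transpose_apply, Matrix.one_apply, smul_eq_mul, Fin.ext_iff]
  split_ifs <;> first | omega | simp

theorem neighbourSum_commutator_position (N : ℕ) :
    neighbourSum N * position N - position N * neighbourSum N = centralDiff N := by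
  ext i j
  simp only [neighbourSum, position, centralDiff, shift, Matrix.sub_apply, mul_diagonal,
    diagonal_mul, Matrix.add_apply, of_apply, transpose_apply]
  split_ifs with h1 h2 h2
  · omega
  · rw [← h1]; push_cast; ring
  · rw [← h2]; push_cast; ring
  · ring

theorem neighbourSum_commutator_centralDiff (N : ℕ) :
    neighbourSum N * centralDiff N - centralDiff N * neighbourSum N
      = (2 : ℝ) • ((diagonal fun i : Fin N => if i.val + 1 = N then (1 : ℝ) else 0)
        - diagonal fun i : Fin N => if i.val = 0 then (1 : ℝ) else 0) := by
  have h : neighbourSum N * centralDiff N - centralDiff N * neighbourSum N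
      = (2 : ℝ) • ((shift N)ᵀ * shift N - shift N * (shift N)ᵀ) := by
    rw [two_smul]
    simp only [neighbourSum, centralDiff]
    noncomm_ring
  rw [h, shift_mul_transpose, shift_transpose_mul]
  congr 1
  abel

/-- The lattice virial identity: the commutator of the coupling with the virial multiplier is
minus the square of the central difference, up to a boundary term. -/
theorem neighbourSum_commutator_virial (hN : 2 ≤ N) :
    neighbourSum N * virial N - virial N * neighbourSum N
      = centralDiff N * centralDiff N + ((N : ℝ) - 1) • endProj N := by
  have hX := neighbourSum_commutator_position N
  have hW := neighbourSum_commutator_centralDiff N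
  have hb : (1 / 2 : ℝ) • (position N * (neighbourSum N * centralDiff N
        - centralDiff N * neighbourSum N)
      + (neighbourSum N * centralDiff N - centralDiff N * neighbourSum N) * position N)
      = ((N : ℝ) - 1) • endProj N := by
    rw [hW]
    ext i j
    simp only [position, endProj, Matrix.smul_apply, Matrix.add_apply, diagonal_mul, mul_diagonal,
      Matrix.sub_apply, diagonal_apply, smul_eq_mul]
    by_cases hij : i = j
    · subst hij
      simp only [if_true]
      by_cases h0 : i.val = 0
      · have h1 : ¬ i.val + 1 = N := by omega
        simp [h0]
        rw [if_neg (by omega)]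
        ring
      · by_cases h1 : i.val + 1 = N
        · have h2 : (i.val : ℝ) = N - 1 := eq_sub_of_add_eq (by exact_mod_cast h1)
          simp [h0, h1, h2]
          ring
        · simp [h0, h1]
    · simp [hij]
  rw [← hb]
  have h2 : centralDiff N * centralDiff N = (1 / 2 : ℝ) •
      ((neighbourSum N * position N - position N * neighbourSum N) * centralDiff N
        + centralDiff N * (neighbourSum N * position N - position N * neighbourSum N)) := by
    rw [hX, ← two_smul ℝ (centralDiff N * centralDiff N), smul_smul]
    norm_num
  rw [h2, ← smul_add, virial, mul_smul_comm, smul_mul_assoc, ← smul_sub]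
  congr 1
  noncomm_ring

/-- At the end sites the virial multiplier only sees the neighbour sum. -/
theorem endProj_mul_virial (N : ℕ) :
    endProj N * virial N = (-(((N : ℝ) - 2) / 2)) • (endProj N * neighbourSum N) := by
  ext i j
  simp only [endProj, virial, position, neighbourSum, centralDiff, shift, diagonal_mul,
    mul_diagonal, Matrix.smul_apply, Matrix.add_apply, Matrix.sub_apply, of_apply,
    transpose_apply, smul_eq_mul]
  by_cases hi : i.val = 0 ∨ i.val + 1 = N
  · rw [if_pos hi]
    rcases hi with hi | hi
    · rw [if_neg (show ¬ j.val + 1 = i.val by omega), hi]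
      by_cases hj : 0 + 1 = j.val
      · rw [if_pos hj, ← hj]; push_cast; ring
      · rw [if_neg hj]; ring
    · rw [if_neg (show ¬ i.val + 1 = j.val by omega)]
      by_cases hj : j.val + 1 = i.val
      · have h2 : (i.val : ℝ) = N - 1 := eq_sub_of_add_eq (by exact_mod_cast hi)
        have h3 : (j.val : ℝ) = N - 2 :=
          eq_sub_of_add_eq (by exact_mod_cast show j.val + 2 = N by omega)
        rw [if_pos hj, h2, h3]; ring
      · rw [if_neg hj]; ring
  · rw [if_neg hi]; ring

end Chain

/-! ### Quadratic estimates on the chain -/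

section Estimates

variable {N : ℕ}

theorem zero_le_dotProduct_self {ι : Type*} [Fintype ι] (u : ι → ℝ) : 0 ≤ u ⬝ᵥ u :=
  Finset.sum_nonneg fun i _ => mul_self_nonneg (u i)

/-- The weighted arithmetic-geometric mean inequality. -/
theorem two_mul_dotProduct_le {ι : Type*} [Fintype ι] (u v : ι → ℝ) {t : ℝ} (ht : 0 < t) :
    2 * (u ⬝ᵥ v) ≤ t * (u ⬝ᵥ u) + t⁻¹ * (v ⬝ᵥ v) := by
  simp only [dotProduct, Finset.mul_sum, ← Finset.sum_add_distrib]
  refine Finset.sum_le_sum fun i _ => ?_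
  have h : t * (u i * u i) + t⁻¹ * (v i * v i) - 2 * (u i * v i) = t⁻¹ * (t * u i - v i) ^ 2 := by
    field_simp
    ring
  have : 0 ≤ t⁻¹ * (t * u i - v i) ^ 2 := by positivity
  linarith

theorem dotProduct_mulVec_eq {ι : Type*} [Fintype ι] (A : Matrix ι ι ℝ) (u v : ι → ℝ) :
    u ⬝ᵥ A *ᵥ v = (Aᵀ *ᵥ u) ⬝ᵥ v := by
  rw [dotProduct_mulVec, mulVec_transpose]

theorem mulVec_dotProduct_mulVec {ι : Type*} [Fintype ι] (A B : Matrix ι ι ℝ) (u v : ι → ℝ) :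
    A *ᵥ u ⬝ᵥ B *ᵥ v = u ⬝ᵥ (Aᵀ * B) *ᵥ v := by
  rw [← mulVec_mulVec, dotProduct_mulVec_eq Aᵀ, transpose_transpose]

theorem add_dotProduct_self_le {ι : Type*} [Fintype ι] (u v : ι → ℝ) :
    (u + v) ⬝ᵥ (u + v) ≤ 2 * (u ⬝ᵥ u) + 2 * (v ⬝ᵥ v) := by
  have := two_mul_dotProduct_le u v one_pos
  simp only [add_dotProduct, dotProduct_add, dotProduct_comm v u]
  linarith

theorem sub_dotProduct_self_le {ι : Type*} [Fintype ι] (u v : ι → ℝ) :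
    (u - v) ⬝ᵥ (u - v) ≤ 2 * (u ⬝ᵥ u) + 2 * (v ⬝ᵥ v) := by
  simpa [sub_eq_add_neg] using add_dotProduct_self_le u (-v)

theorem diagonal_form_nonneg {ι : Type*} [Fintype ι] [DecidableEq ι] {d : ι → ℝ}
    (hd : ∀ i, 0 ≤ d i) (u : ι → ℝ) : 0 ≤ u ⬝ᵥ diagonal d *ᵥ u := by
  simp only [dotProduct, mulVec_diagonal]
  exact Finset.sum_nonneg fun i _ => by nlinarith [hd i, mul_self_nonneg (u i)]

theorem shift_mulVec_le (u : Fin N → ℝ) : shift N *ᵥ u ⬝ᵥ shift N *ᵥ u ≤ u ⬝ᵥ u := by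
  rw [mulVec_dotProduct_mulVec, shift_transpose_mul, sub_mulVec, one_mulVec, dotProduct_sub,
    sub_le_self_iff]
  exact diagonal_form_nonneg (fun i => by positivity) u

theorem shift_transpose_mulVec_le (u : Fin N → ℝ) :
    (shift N)ᵀ *ᵥ u ⬝ᵥ (shift N)ᵀ *ᵥ u ≤ u ⬝ᵥ u := by
  rw [mulVec_dotProduct_mulVec, transpose_transpose, shift_mul_transpose, sub_mulVec, one_mulVec,
    dotProduct_sub, sub_le_self_iff]
  exact diagonal_form_nonneg (fun i => by positivity) u

theorem neighbourSum_mulVec_le (u : Fin N → ℝ) :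
    neighbourSum N *ᵥ u ⬝ᵥ neighbourSum N *ᵥ u ≤ 4 * (u ⬝ᵥ u) := by
  have := add_dotProduct_self_le (shift N *ᵥ u) ((shift N)ᵀ *ᵥ u)
  rw [neighbourSum, add_mulVec]
  linarith [shift_mulVec_le u, shift_transpose_mulVec_le u]

theorem centralDiff_mulVec_le (u : Fin N → ℝ) :
    centralDiff N *ᵥ u ⬝ᵥ centralDiff N *ᵥ u ≤ 4 * (u ⬝ᵥ u) := by
  have := sub_dotProduct_self_le (shift N *ᵥ u) ((shift N)ᵀ *ᵥ u)
  rw [centralDiff, sub_mulVec]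
  linarith [shift_mulVec_le u, shift_transpose_mulVec_le u]

theorem position_mulVec_le (u : Fin N → ℝ) :
    position N *ᵥ u ⬝ᵥ position N *ᵥ u ≤ (N : ℝ) ^ 2 / 4 * (u ⬝ᵥ u) := by
  simp only [position, dotProduct, mulVec_diagonal, Finset.mul_sum]
  refine Finset.sum_le_sum fun i _ => ?_
  have h1 : (i : ℝ) + 1 ≤ N := by exact_mod_cast i.isLt
  have h0 : (0 : ℝ) ≤ i := by positivity
  have h2 : ((i : ℝ) - ((N : ℝ) - 1) / 2) ^ 2 ≤ (N : ℝ) ^ 2 / 4 := by nlinarith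
  nlinarith [mul_self_nonneg (u i)]

theorem virial_form_le (hN : 2 ≤ N) (w u : Fin N → ℝ) :
    2 * (w ⬝ᵥ virial N *ᵥ u) ≤ N * (w ⬝ᵥ w + u ⬝ᵥ u) := by
  have hN0 : (0 : ℝ) < N := by exact_mod_cast (by omega : 0 < N)
  have key (w u : Fin N → ℝ) :
      2 * (position N *ᵥ w ⬝ᵥ centralDiff N *ᵥ u) ≤ N * (w ⬝ᵥ w + u ⬝ᵥ u) := by
    have h := two_mul_dotProduct_le (position N *ᵥ w) (centralDiff N *ᵥ u)
      (t := 4 / N) (by positivity)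
    have h1 := mul_le_mul_of_nonneg_left (position_mulVec_le w)
      (by positivity : (0 : ℝ) ≤ 4 / N)
    have h2 := mul_le_mul_of_nonneg_left (centralDiff_mulVec_le u)
      (by positivity : (0 : ℝ) ≤ (4 / N : ℝ)⁻¹)
    have e1 : 4 / (N : ℝ) * ((N : ℝ) ^ 2 / 4 * (w ⬝ᵥ w)) = N * (w ⬝ᵥ w) := by field_simp
    have e2 : (4 / (N : ℝ))⁻¹ * (4 * (u ⬝ᵥ u)) = N * (u ⬝ᵥ u) := by field_simp
    linarith
  have e : 2 * (w ⬝ᵥ virial N *ᵥ u) = position N *ᵥ w ⬝ᵥ centralDiff N *ᵥ u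
      + position N *ᵥ (-u) ⬝ᵥ centralDiff N *ᵥ w := by
    have h1 : w ⬝ᵥ (position N * centralDiff N) *ᵥ u
        = position N *ᵥ w ⬝ᵥ centralDiff N *ᵥ u := by
      rw [mulVec_dotProduct_mulVec, transpose_position]
    have h2 : w ⬝ᵥ (centralDiff N * position N) *ᵥ u
        = position N *ᵥ (-u) ⬝ᵥ centralDiff N *ᵥ w := by
      rw [← mulVec_mulVec, dotProduct_mulVec_eq, transpose_centralDiff, dotProduct_comm]
      simp [neg_mulVec, mulVec_neg]
    rw [virial, smul_mulVec, add_mulVec, dotProduct_smul, dotProduct_add, h1, h2, smul_eq_mul]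
    ring
  have h1 := key w u
  have h2 := key (-u) w
  simp only [neg_dotProduct_neg] at h2
  linarith

theorem dotProduct_virial_self (u : Fin N → ℝ) : u ⬝ᵥ virial N *ᵥ u = 0 := by
  have h := dotProduct_mulVec_eq (virial N) u u
  rw [transpose_virial, neg_mulVec, neg_dotProduct, dotProduct_comm _ u] at h
  linarith

theorem dotProduct_neighbourSum_virial (hN : 2 ≤ N) (u : Fin N → ℝ) :
    2 * (neighbourSum N *ᵥ u ⬝ᵥ virial N *ᵥ u)
      = -(centralDiff N *ᵥ u ⬝ᵥ centralDiff N *ᵥ u)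
        + ((N : ℝ) - 1) * (u ⬝ᵥ endProj N *ᵥ u) := by
  have h1 : neighbourSum N *ᵥ u ⬝ᵥ virial N *ᵥ u
      = u ⬝ᵥ (neighbourSum N * virial N) *ᵥ u := by
    rw [mulVec_dotProduct_mulVec, transpose_neighbourSum]
  have h2 : neighbourSum N *ᵥ u ⬝ᵥ virial N *ᵥ u
      = -(u ⬝ᵥ (virial N * neighbourSum N) *ᵥ u) := by
    rw [dotProduct_comm, mulVec_dotProduct_mulVec, transpose_virial, neg_mul, neg_mulVec,
      dotProduct_neg]
  have h3 : centralDiff N *ᵥ u ⬝ᵥ centralDiff N *ᵥ u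
      = -(u ⬝ᵥ (centralDiff N * centralDiff N) *ᵥ u) := by
    rw [mulVec_dotProduct_mulVec, transpose_centralDiff, neg_mul, neg_mulVec, dotProduct_neg]
  have h4 := congrArg (fun A => u ⬝ᵥ A *ᵥ u) (neighbourSum_commutator_virial hN)
  simp only [sub_mulVec, add_mulVec, dotProduct_sub, dotProduct_add, smul_mulVec,
    dotProduct_smul, smul_eq_mul] at h4
  linarith

theorem endProj_form_nonneg (u : Fin N → ℝ) : 0 ≤ u ⬝ᵥ endProj N *ᵥ u :=
  diagonal_form_nonneg (fun i => by positivity) u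

theorem endProj_form_eq (u v : Fin N → ℝ) :
    endProj N *ᵥ u ⬝ᵥ endProj N *ᵥ v = u ⬝ᵥ endProj N *ᵥ v := by
  rw [mulVec_dotProduct_mulVec, transpose_endProj, endProj_mul_self]

theorem two_mul_endProj_le (u v : Fin N → ℝ) :
    2 * (u ⬝ᵥ endProj N *ᵥ v) ≤ u ⬝ᵥ endProj N *ᵥ u + v ⬝ᵥ endProj N *ᵥ v := by
  have := two_mul_dotProduct_le (endProj N *ᵥ u) (endProj N *ᵥ v) one_pos
  simp only [endProj_form_eq] at this
  linarith

theorem endProj_form_add_le (u v : Fin N → ℝ) :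
    (u + v) ⬝ᵥ endProj N *ᵥ (u + v)
      ≤ 2 * (u ⬝ᵥ endProj N *ᵥ u) + 2 * (v ⬝ᵥ endProj N *ᵥ v) := by
  have := add_dotProduct_self_le (endProj N *ᵥ u) (endProj N *ᵥ v)
  rw [← mulVec_add] at this
  simpa only [endProj_form_eq] using this

theorem endProj_form_smul (t : ℝ) (u : Fin N → ℝ) :
    (t • u) ⬝ᵥ endProj N *ᵥ (t • u) = t ^ 2 * (u ⬝ᵥ endProj N *ᵥ u) := by
  simp only [mulVec_smul, smul_dotProduct, dotProduct_smul, smul_eq_mul]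
  ring

theorem endProj_form_le (u : Fin N → ℝ) : u ⬝ᵥ endProj N *ᵥ u ≤ u ⬝ᵥ u := by
  simp only [endProj, dotProduct, mulVec_diagonal]
  refine Finset.sum_le_sum fun i _ => ?_
  split_ifs <;> nlinarith [mul_self_nonneg (u i)]

theorem centralDiff_mulVec_zero (u : Fin N → ℝ) (h : 1 < N) :
    (centralDiff N *ᵥ u) ⟨0, by omega⟩ = u ⟨1, h⟩ := by
  simp only [centralDiff, shift, mulVec, dotProduct, Matrix.sub_apply, of_apply, transpose_apply]
  rw [Finset.sum_eq_single ⟨1, h⟩]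
  · simp
  · intro k _ hk
    have : ¬ 1 = k.val := fun h => hk (Fin.ext h.symm)
    simp [this]
  · simp

theorem centralDiff_mulVec_succ (u : Fin N → ℝ) {j : ℕ} (h : j + 2 < N) :
    (centralDiff N *ᵥ u) ⟨j + 1, by omega⟩ = u ⟨j + 2, h⟩ - u ⟨j, by omega⟩ := by
  have hne : (⟨j + 2, h⟩ : Fin N) ≠ ⟨j, by omega⟩ := by simp
  simp only [centralDiff, shift, mulVec, dotProduct, Matrix.sub_apply, of_apply, transpose_apply]
  rw [Finset.sum_eq_add _ _ hne]
  · simp [show ¬ j + 1 + 1 = j by omega]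
    ring
  · intro k _ hk
    have h1 : ¬ j + 1 + 1 = k.val := fun h => hk.1 (Fin.ext h.symm)
    have h2 : ¬ k.val + 1 = j + 1 := fun h => hk.2 (Fin.ext (by simp; omega))
    rw [if_neg h1, if_neg h2]
    ring
  · simp
  · simp

/-- Every entry is reached from the left end by steps of length two, each costing one entry of
the central difference (odd sites start from `u₁ = (D u)₀`). -/
theorem abs_apply_le_add_sum (u : Fin N → ℝ) (h0 : 0 < N) (j : ℕ) (hj : j < N) :
    |u ⟨j, hj⟩| ≤ |u ⟨0, h0⟩|
      + ∑ i ∈ Finset.univ.filter (fun i : Fin N => i.val < j), |(centralDiff N *ᵥ u) i| := by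
  induction j using Nat.strong_induction_on with
  | _ j ih =>
    match j, hj, ih with
    | 0, _, _ => simp
    | 1, hj, _ =>
      rw [← centralDiff_mulVec_zero u hj]
      refine le_add_of_nonneg_of_le (abs_nonneg _) ?_
      exact Finset.single_le_sum (f := fun i => |(centralDiff N *ᵥ u) i|)
        (fun i _ => abs_nonneg _) (by simp)
    | j + 2, hj, ih =>
      have h1 := ih j (by omega) (by omega)
      have h2 : u ⟨j + 2, hj⟩ = u ⟨j, by omega⟩ + (centralDiff N *ᵥ u) ⟨j + 1, by omega⟩ := by
        rw [centralDiff_mulVec_succ u hj]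
        ring
      have h3 : ∑ i ∈ Finset.univ.filter (fun i : Fin N => i.val < j), |(centralDiff N *ᵥ u) i|
          + |(centralDiff N *ᵥ u) ⟨j + 1, by omega⟩|
          ≤ ∑ i ∈ Finset.univ.filter (fun i : Fin N => i.val < j + 2),
            |(centralDiff N *ᵥ u) i| := by
        rw [add_comm, ← Finset.sum_insert (f := fun i => |(centralDiff N *ᵥ u) i|) (by simp)]
        refine Finset.sum_le_sum_of_subset_of_nonneg (fun i hi => ?_) fun i _ _ => abs_nonneg _
        simp only [Finset.mem_insert, Finset.mem_filter, Finset.mem_univ, true_and] at hi ⊢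
        rcases hi with rfl | hi
        · simp
        · omega
      rw [h2]
      linarith [abs_add_le (u ⟨j, by omega⟩) ((centralDiff N *ᵥ u) ⟨j + 1, by omega⟩)]

/-- Discrete Poincaré inequality for the central difference. The boundary term is needed: for odd
`N` the central difference kills the alternating vector `(1, 0, 1, 0, …, 1)`. -/
theorem dotProduct_self_le_poincare (hN : 2 ≤ N) (u : Fin N → ℝ) :
    u ⬝ᵥ u ≤ 2 * N * (u ⬝ᵥ endProj N *ᵥ u)
      + 2 * (N : ℝ) ^ 2 * (centralDiff N *ᵥ u ⬝ᵥ centralDiff N *ᵥ u) := by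
  have h0 : 0 < N := by omega
  set d := centralDiff N *ᵥ u with hd
  have hend : u ⟨0, h0⟩ ^ 2 ≤ u ⬝ᵥ endProj N *ᵥ u := by
    simp only [endProj, dotProduct, mulVec_diagonal]
    refine le_trans (le_of_eq ?_) (Finset.single_le_sum
      (f := fun i => u i * ((if i.val = 0 ∨ i.val + 1 = N then (1 : ℝ) else 0) * u i))
      (fun i _ => ?_) (Finset.mem_univ ⟨0, h0⟩))
    · simp [sq]
    · split_ifs <;> nlinarith [mul_self_nonneg (u i)]
  have hcs : (∑ i, |d i|) ^ 2 ≤ N * (d ⬝ᵥ d) := by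
    have := sq_sum_le_card_mul_sum_sq (s := Finset.univ) (f := fun i => |d i|)
    simpa [dotProduct, sq] using this
  have hpt (j : Fin N) : u j * u j ≤ 2 * (u ⬝ᵥ endProj N *ᵥ u) + 2 * N * (d ⬝ᵥ d) := by
    have h1 : |u j| ≤ |u ⟨0, h0⟩| + ∑ i, |d i| :=
      (abs_apply_le_add_sum u h0 j j.isLt).trans (add_le_add le_rfl
        (Finset.sum_le_sum_of_subset_of_nonneg (Finset.filter_subset _ _)
          fun i _ _ => abs_nonneg _))
    have h2 : |u j| ^ 2 ≤ (|u ⟨0, h0⟩| + ∑ i, |d i|) ^ 2 :=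
      pow_le_pow_left₀ (abs_nonneg _) h1 2
    rw [sq_abs] at h2
    nlinarith [sq_nonneg (|u ⟨0, h0⟩| - ∑ i, |d i|), sq_abs (u ⟨0, h0⟩)]
  calc u ⬝ᵥ u ≤ ∑ _j : Fin N, (2 * (u ⬝ᵥ endProj N *ᵥ u) + 2 * N * (d ⬝ᵥ d)) :=
        Finset.sum_le_sum fun j _ => hpt j
    _ = _ := by simp; ring

section Force

variable {a c : ℝ}

theorem forceMatrix_mulVec (a c : ℝ) (u : Fin N → ℝ) :
    forceMatrix a c N *ᵥ u = (a + 2 * c) • u - c • neighbourSum N *ᵥ u := by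
  rw [forceMatrix_eq, sub_mulVec, smul_mulVec, smul_mulVec, one_mulVec]

theorem transpose_forceMatrix (a c : ℝ) (N : ℕ) : (forceMatrix a c N)ᵀ = forceMatrix a c N := by
  simp [forceMatrix_eq, transpose_neighbourSum]

theorem abs_neighbourSum_form_le (u : Fin N → ℝ) :
    |u ⬝ᵥ neighbourSum N *ᵥ u| ≤ 2 * (u ⬝ᵥ u) := by
  have e : u ⬝ᵥ neighbourSum N *ᵥ u = 2 * (u ⬝ᵥ shift N *ᵥ u) := by
    rw [neighbourSum, add_mulVec, dotProduct_add, dotProduct_mulVec_eq (shift N)ᵀ,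
      transpose_transpose, dotProduct_comm _ u]
    ring
  have h1 := two_mul_dotProduct_le u (shift N *ᵥ u) one_pos
  have h2 := two_mul_dotProduct_le (-u) (shift N *ᵥ u) one_pos
  have h3 := shift_mulVec_le u
  simp only [neg_dotProduct, dotProduct_neg, neg_neg] at h2
  rw [e, abs_le]
  constructor <;> linarith

theorem le_forceMatrix_form (hc : 0 < c) (u : Fin N → ℝ) :
    a * (u ⬝ᵥ u) ≤ u ⬝ᵥ forceMatrix a c N *ᵥ u := by
  rw [forceMatrix_mulVec, dotProduct_sub, dotProduct_smul, dotProduct_smul, smul_eq_mul,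
    smul_eq_mul]
  nlinarith [(abs_le.mp (abs_neighbourSum_form_le u)).2]

theorem forceMatrix_form_le (hc : 0 < c) (u : Fin N → ℝ) :
    u ⬝ᵥ forceMatrix a c N *ᵥ u ≤ (a + 4 * c) * (u ⬝ᵥ u) := by
  rw [forceMatrix_mulVec, dotProduct_sub, dotProduct_smul, dotProduct_smul, smul_eq_mul,
    smul_eq_mul]
  nlinarith [(abs_le.mp (abs_neighbourSum_form_le u)).1]

theorem forceMatrix_mulVec_le (a c : ℝ) (u : Fin N → ℝ) :
    forceMatrix a c N *ᵥ u ⬝ᵥ forceMatrix a c N *ᵥ u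
      ≤ (2 * (a + 2 * c) ^ 2 + 8 * c ^ 2) * (u ⬝ᵥ u) := by
  rw [forceMatrix_mulVec]
  have h := sub_dotProduct_self_le ((a + 2 * c) • u) (c • neighbourSum N *ᵥ u)
  simp only [smul_dotProduct, dotProduct_smul, smul_eq_mul] at h
  nlinarith [mul_le_mul_of_nonneg_left (neighbourSum_mulVec_le u) (sq_nonneg c)]

theorem isUnit_det_forceMatrix (ha : 0 < a) (hc : 0 < c) (N : ℕ) :
    IsUnit (forceMatrix a c N).det := by
  rw [isUnit_iff_ne_zero]
  intro h
  obtain ⟨v, hv, hBv⟩ := exists_mulVec_eq_zero_iff.mpr h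
  have h1 := le_forceMatrix_form (a := a) hc v
  rw [hBv, dotProduct_zero] at h1
  have h2 : v ⬝ᵥ v = 0 := le_antisymm (by nlinarith) (zero_le_dotProduct_self v)
  exact hv (dotProduct_self_eq_zero.mp h2)

theorem forceMatrix_inv_form (ha : 0 < a) (hc : 0 < c) (q : Fin N → ℝ) :
    0 ≤ q ⬝ᵥ (forceMatrix a c N)⁻¹ *ᵥ q ∧
      a * (q ⬝ᵥ (forceMatrix a c N)⁻¹ *ᵥ q) ≤ q ⬝ᵥ q := by
  set y := (forceMatrix a c N)⁻¹ *ᵥ q with hy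
  have hq : forceMatrix a c N *ᵥ y = q := by
    rw [hy, mulVec_mulVec, mul_nonsing_inv _ (isUnit_det_forceMatrix ha hc N), one_mulVec]
  have h1 := le_forceMatrix_form (a := a) hc y
  rw [hq, dotProduct_comm y q] at h1
  have h2 := zero_le_dotProduct_self y
  have h3 := zero_le_dotProduct_self (q - a • y)
  simp only [sub_dotProduct, dotProduct_sub, smul_dotProduct, dotProduct_smul, smul_eq_mul,
    dotProduct_comm y q] at h3
  have h4 := mul_le_mul_of_nonneg_left h1 ha.le
  exact ⟨(mul_nonneg ha.le h2).trans h1, by linarith⟩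

theorem forceMatrix_form_virial (hN : 2 ≤ N) (a c : ℝ) (u : Fin N → ℝ) :
    2 * (forceMatrix a c N *ᵥ u ⬝ᵥ virial N *ᵥ u)
      = c * (centralDiff N *ᵥ u ⬝ᵥ centralDiff N *ᵥ u)
        - c * ((N : ℝ) - 1) * (u ⬝ᵥ endProj N *ᵥ u) := by
  have h := dotProduct_neighbourSum_virial hN u
  rw [forceMatrix_mulVec, sub_dotProduct, smul_dotProduct, smul_dotProduct, smul_eq_mul,
    smul_eq_mul, dotProduct_virial_self]
  linear_combination (-c) * h

end Force

end Estimates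

/-! ### The Lyapunov matrix of the chain -/

section Supersolution

variable {N : ℕ} {a c γ : ℝ}

theorem dotProduct_sum_elim (x y : Fin N ⊕ Fin N → ℝ) :
    x ⬝ᵥ y = (x ∘ Sum.inl) ⬝ᵥ (y ∘ Sum.inl) + (x ∘ Sum.inr) ⬝ᵥ (y ∘ Sum.inr) := by
  simp [dotProduct, Fintype.sum_sum_type]

theorem driftMatrix_mulVec_inl (a c γ : ℝ) (x : Fin N ⊕ Fin N → ℝ) :
    (driftMatrix a c γ N *ᵥ x) ∘ Sum.inl
      = γ • endProj N *ᵥ (x ∘ Sum.inl) - x ∘ Sum.inr := by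
  ext i
  simp [driftMatrix, fromBlocks_mulVec, frictionMatrix_eq, neg_mulVec, smul_mulVec,
    sub_eq_add_neg]

theorem driftMatrix_mulVec_inr (a c γ : ℝ) (x : Fin N ⊕ Fin N → ℝ) :
    (driftMatrix a c γ N *ᵥ x) ∘ Sum.inr = forceMatrix a c N *ᵥ (x ∘ Sum.inl) := by
  ext i
  simp [driftMatrix, fromBlocks_mulVec]

/-- The conserved energy `|u|² + ⟨q, B⁻¹ q⟩` of the frictionless flow `(u, q)' = -M (u, q)`. -/
noncomputable def energyMatrix (a c : ℝ) (N : ℕ) : Matrix (Fin N ⊕ Fin N) (Fin N ⊕ Fin N) ℝ :=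
  fromBlocks 1 0 0 (forceMatrix a c N)⁻¹

theorem energyMatrix_form (x : Fin N ⊕ Fin N → ℝ) :
    x ⬝ᵥ energyMatrix a c N *ᵥ x = (x ∘ Sum.inl) ⬝ᵥ (x ∘ Sum.inl)
      + (x ∘ Sum.inr) ⬝ᵥ (forceMatrix a c N)⁻¹ *ᵥ (x ∘ Sum.inr) := by
  rw [dotProduct_sum_elim]
  congr 2 <;> ext i <;> simp [energyMatrix, fromBlocks_mulVec]

theorem transpose_energyMatrix (a c : ℝ) (N : ℕ) :
    (energyMatrix a c N)ᵀ = energyMatrix a c N := by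
  simp [energyMatrix, fromBlocks_transpose, transpose_nonsing_inv, transpose_forceMatrix]

theorem energyMatrix_lyapunov (ha : 0 < a) (hc : 0 < c) (γ : ℝ) (N : ℕ) :
    energyMatrix a c N * driftMatrix a c γ N + (driftMatrix a c γ N)ᵀ * energyMatrix a c N
      = fromBlocks ((2 * γ) • endProj N) 0 0 0 := by
  have hB := isUnit_det_forceMatrix ha hc N
  simp [energyMatrix, driftMatrix, fromBlocks_transpose, fromBlocks_multiply, fromBlocks_add,
    transpose_forceMatrix, nonsing_inv_mul _ hB, mul_nonsing_inv _ hB, frictionMatrix_eq,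
    transpose_endProj, two_mul, add_smul]

theorem energyMatrix_lyapunov_form (ha : 0 < a) (hc : 0 < c) (γ : ℝ)
    (x : Fin N ⊕ Fin N → ℝ) :
    x ⬝ᵥ (energyMatrix a c N * driftMatrix a c γ N
        + (driftMatrix a c γ N)ᵀ * energyMatrix a c N) *ᵥ x
      = 2 * γ * ((x ∘ Sum.inl) ⬝ᵥ endProj N *ᵥ (x ∘ Sum.inl)) := by
  rw [energyMatrix_lyapunov ha hc, dotProduct_sum_elim]
  have h1 : (fromBlocks ((2 * γ) • endProj N) 0 0 (0 : Matrix (Fin N) (Fin N) ℝ) *ᵥ x) ∘ Sum.inl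
      = (2 * γ) • endProj N *ᵥ (x ∘ Sum.inl) := by
    ext i
    simp [fromBlocks_mulVec, smul_mulVec]
  have h2 : (fromBlocks ((2 * γ) • endProj N) 0 0 (0 : Matrix (Fin N) (Fin N) ℝ) *ᵥ x) ∘ Sum.inr
      = 0 := by
    ext i
    simp [fromBlocks_mulVec]
  rw [h1, h2, dotProduct_zero, add_zero, dotProduct_smul, smul_eq_mul]

theorem congr_form {ι : Type*} [Fintype ι] (A E : Matrix ι ι ℝ) (x : ι → ℝ) :
    x ⬝ᵥ (Aᵀ * E * A) *ᵥ x = (A *ᵥ x) ⬝ᵥ E *ᵥ (A *ᵥ x) := by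
  rw [← mulVec_mulVec, ← mulVec_mulVec, dotProduct_mulVec_eq Aᵀ, transpose_transpose]

/-- Replacing `E` by `Aᵀ E A`, with `A` commuting with `M`, amounts to evaluating the Lyapunov
form at `A x`. -/
theorem congr_lyapunov_form {ι : Type*} [Fintype ι] {A M : Matrix ι ι ℝ} (h : A * M = M * A)
    (E : Matrix ι ι ℝ) (x : ι → ℝ) :
    x ⬝ᵥ (Aᵀ * E * A * M + Mᵀ * (Aᵀ * E * A)) *ᵥ x
      = (A *ᵥ x) ⬝ᵥ (E * M + Mᵀ * E) *ᵥ (A *ᵥ x) := by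
  rw [← congr_form]
  have ht : Mᵀ * Aᵀ = Aᵀ * Mᵀ := by rw [← transpose_mul, h, transpose_mul]
  congr 2
  rw [mul_add, add_mul, Matrix.mul_assoc _ A M, h, ← Matrix.mul_assoc Mᵀ, ← Matrix.mul_assoc Mᵀ,
    ht]
  simp only [Matrix.mul_assoc]

/-- The matrix of the bilinear form `-⟨(M x)₁, K y₁⟩`, where the index `1` denotes the first block
of coordinates. -/
noncomputable def multiplierMatrix (γ : ℝ) (K : Matrix (Fin N) (Fin N) ℝ) :
    Matrix (Fin N ⊕ Fin N) (Fin N ⊕ Fin N) ℝ :=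
  fromBlocks (-(γ • (endProj N * K))) 0 K 0

theorem multiplierMatrix_form (a c γ : ℝ) (K : Matrix (Fin N) (Fin N) ℝ)
    (x y : Fin N ⊕ Fin N → ℝ) :
    x ⬝ᵥ multiplierMatrix γ K *ᵥ y
      = -(((driftMatrix a c γ N *ᵥ x) ∘ Sum.inl) ⬝ᵥ K *ᵥ (y ∘ Sum.inl)) := by
  have h1 : (multiplierMatrix γ K *ᵥ y) ∘ Sum.inl
      = -(γ • endProj N *ᵥ (K *ᵥ (y ∘ Sum.inl))) := by
    ext i
    simp [multiplierMatrix, fromBlocks_mulVec, neg_mulVec, smul_mulVec]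
  have h2 : (multiplierMatrix γ K *ᵥ y) ∘ Sum.inr = K *ᵥ (y ∘ Sum.inl) := by
    ext i
    simp [multiplierMatrix, fromBlocks_mulVec]
  rw [dotProduct_sum_elim, h1, h2, driftMatrix_mulVec_inl, sub_dotProduct, smul_dotProduct,
    dotProduct_neg, dotProduct_smul, dotProduct_mulVec_eq (endProj N), transpose_endProj]
  ring

theorem symm_form {ι : Type*} [Fintype ι] (R : Matrix ι ι ℝ) (x : ι → ℝ) :
    x ⬝ᵥ (R + Rᵀ) *ᵥ x = 2 * (x ⬝ᵥ R *ᵥ x) := by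
  rw [add_mulVec, dotProduct_add, dotProduct_mulVec_eq Rᵀ, transpose_transpose,
    dotProduct_comm _ x]
  ring

theorem symm_lyapunov_form {ι : Type*} [Fintype ι] (R M : Matrix ι ι ℝ) (x : ι → ℝ) :
    x ⬝ᵥ ((R + Rᵀ) * M + Mᵀ * (R + Rᵀ)) *ᵥ x
      = 2 * (x ⬝ᵥ R *ᵥ (M *ᵥ x) + (M *ᵥ x) ⬝ᵥ R *ᵥ x) := by
  have e : (R + Rᵀ) * M + Mᵀ * (R + Rᵀ) = (R * M + Mᵀ * R) + (R * M + Mᵀ * R)ᵀ := by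
    simp only [transpose_add, transpose_mul, transpose_transpose]
    noncomm_ring
  rw [e, symm_form, add_mulVec, dotProduct_add, ← mulVec_mulVec, ← mulVec_mulVec,
    dotProduct_mulVec_eq Mᵀ, transpose_transpose]

/-- The candidate Lyapunov matrix: `κ N³` times the energies of `x`, `M x` and `M² x`, plus the
symmetrized virial functional weighted by `N²` and corrected by `-δ`. -/
noncomputable def superMatrix (a c γ κ δ : ℝ) (N : ℕ) :
    Matrix (Fin N ⊕ Fin N) (Fin N ⊕ Fin N) ℝ :=
  (κ * (N : ℝ) ^ 3) • (energyMatrix a c N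
      + (driftMatrix a c γ N)ᵀ * energyMatrix a c N * driftMatrix a c γ N
      + (driftMatrix a c γ N * driftMatrix a c γ N)ᵀ * energyMatrix a c N
        * (driftMatrix a c γ N * driftMatrix a c γ N))
    + (multiplierMatrix γ ((N : ℝ) ^ 2 • virial N - δ • 1)
      + (multiplierMatrix γ ((N : ℝ) ^ 2 • virial N - δ • 1))ᵀ)

theorem transpose_superMatrix (a c γ κ δ : ℝ) (N : ℕ) :
    (superMatrix a c γ κ δ N)ᵀ = superMatrix a c γ κ δ N := by
  simp only [superMatrix, transpose_add, transpose_smul, transpose_mul, transpose_energyMatrix,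
    transpose_transpose, Matrix.mul_assoc]
  rw [add_comm (multiplierMatrix γ ((N : ℝ) ^ 2 • virial N - δ • 1))ᵀ]

theorem superMatrix_form (a c γ κ δ : ℝ) (x : Fin N ⊕ Fin N → ℝ) :
    x ⬝ᵥ superMatrix a c γ κ δ N *ᵥ x
      = κ * (N : ℝ) ^ 3 * (x ⬝ᵥ energyMatrix a c N *ᵥ x
          + (driftMatrix a c γ N *ᵥ x) ⬝ᵥ energyMatrix a c N *ᵥ (driftMatrix a c γ N *ᵥ x)
          + (driftMatrix a c γ N *ᵥ driftMatrix a c γ N *ᵥ x) ⬝ᵥ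
            energyMatrix a c N *ᵥ (driftMatrix a c γ N *ᵥ driftMatrix a c γ N *ᵥ x))
        - (N : ℝ) ^ 2 * (2 * (((driftMatrix a c γ N *ᵥ x) ∘ Sum.inl)
            ⬝ᵥ virial N *ᵥ (x ∘ Sum.inl)))
        + δ * (2 * (((driftMatrix a c γ N *ᵥ x) ∘ Sum.inl) ⬝ᵥ (x ∘ Sum.inl))) := by
  rw [superMatrix, add_mulVec, dotProduct_add, smul_mulVec, dotProduct_smul, smul_eq_mul,
    add_mulVec, add_mulVec, dotProduct_add, dotProduct_add, congr_form, congr_form, symm_form,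
    multiplierMatrix_form a c, ← mulVec_mulVec, sub_mulVec, dotProduct_sub, smul_mulVec,
    smul_mulVec, one_mulVec, dotProduct_smul, dotProduct_smul, smul_eq_mul, smul_eq_mul]
  ring

theorem superMatrix_lyapunov_form (ha : 0 < a) (hc : 0 < c) (hN : 2 ≤ N) (γ κ δ : ℝ)
    (x : Fin N ⊕ Fin N → ℝ) {u h g : Fin N → ℝ} (hu : u = x ∘ Sum.inl)
    (hh : h = (driftMatrix a c γ N *ᵥ x) ∘ Sum.inl)
    (hg : g = (driftMatrix a c γ N *ᵥ driftMatrix a c γ N *ᵥ x) ∘ Sum.inl) :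
    x ⬝ᵥ (superMatrix a c γ κ δ N * driftMatrix a c γ N
        + (driftMatrix a c γ N)ᵀ * superMatrix a c γ κ δ N) *ᵥ x
      = κ * (N : ℝ) ^ 3 * (2 * γ * (u ⬝ᵥ endProj N *ᵥ u + h ⬝ᵥ endProj N *ᵥ h
          + g ⬝ᵥ endProj N *ᵥ g))
        + 2 * δ * (h ⬝ᵥ h) + δ * γ * (2 * (h ⬝ᵥ endProj N *ᵥ u))
        - 2 * δ * (u ⬝ᵥ forceMatrix a c N *ᵥ u)
        + (N : ℝ) ^ 2 * (γ * ((N : ℝ) - 2) * (h ⬝ᵥ endProj N *ᵥ (neighbourSum N *ᵥ u))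
          + c * (centralDiff N *ᵥ u ⬝ᵥ centralDiff N *ᵥ u)
          - c * ((N : ℝ) - 1) * (u ⬝ᵥ endProj N *ᵥ u)) := by
  set M := driftMatrix a c γ N with hM
  set E := energyMatrix a c N with hE
  set K := (N : ℝ) ^ 2 • virial N - δ • (1 : Matrix (Fin N) (Fin N) ℝ) with hK
  have e : superMatrix a c γ κ δ N * M + Mᵀ * superMatrix a c γ κ δ N
      = (κ * (N : ℝ) ^ 3) • ((E * M + Mᵀ * E) + (Mᵀ * E * M * M + Mᵀ * (Mᵀ * E * M))
          + ((M * M)ᵀ * E * (M * M) * M + Mᵀ * ((M * M)ᵀ * E * (M * M))))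
        + ((multiplierMatrix γ K + (multiplierMatrix γ K)ᵀ) * M
          + Mᵀ * (multiplierMatrix γ K + (multiplierMatrix γ K)ᵀ)) := by
    rw [superMatrix, add_mul, mul_add, smul_mul_assoc, mul_smul_comm]
    simp only [add_mul, mul_add, smul_add]
    abel
  have hgu : g = γ • endProj N *ᵥ h - forceMatrix a c N *ᵥ u := by
    rw [hg, hM, driftMatrix_mulVec_inl, driftMatrix_mulVec_inr, ← hM, ← hh, ← hu]
  have hBK := forceMatrix_form_virial hN a c u
  have hEK : endProj N *ᵥ h ⬝ᵥ virial N *ᵥ u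
      = -(((N : ℝ) - 2) / 2) * (h ⬝ᵥ endProj N *ᵥ (neighbourSum N *ᵥ u)) := by
    rw [mulVec_dotProduct_mulVec, transpose_endProj, endProj_mul_virial, smul_mulVec,
      dotProduct_smul, smul_eq_mul, mulVec_mulVec]
  have hEu : endProj N *ᵥ h ⬝ᵥ u = h ⬝ᵥ endProj N *ᵥ u := by
    rw [dotProduct_mulVec_eq (endProj N) h u, transpose_endProj]
  have hgK : g ⬝ᵥ virial N *ᵥ u = γ * (endProj N *ᵥ h ⬝ᵥ virial N *ᵥ u)
      - forceMatrix a c N *ᵥ u ⬝ᵥ virial N *ᵥ u := by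
    rw [hgu, sub_dotProduct, smul_dotProduct, smul_eq_mul]
  have hgu' : g ⬝ᵥ u = γ * (h ⬝ᵥ endProj N *ᵥ u) - u ⬝ᵥ forceMatrix a c N *ᵥ u := by
    rw [hgu, sub_dotProduct, smul_dotProduct, smul_eq_mul, hEu, dotProduct_comm u]
  rw [e, add_mulVec, dotProduct_add, smul_mulVec, dotProduct_smul, smul_eq_mul, add_mulVec,
    add_mulVec, dotProduct_add, dotProduct_add, congr_lyapunov_form rfl,
    congr_lyapunov_form (Matrix.mul_assoc M M M), symm_lyapunov_form,
    energyMatrix_lyapunov_form ha hc, energyMatrix_lyapunov_form ha hc,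
    energyMatrix_lyapunov_form ha hc, multiplierMatrix_form a c, multiplierMatrix_form a c,
    ← mulVec_mulVec, ← hM, ← hu, ← hh, ← hg, hK]
  simp only [sub_mulVec, smul_mulVec, one_mulVec, dotProduct_sub, dotProduct_smul, smul_eq_mul,
    dotProduct_virial_self]
  rw [hgK, hgu', hEK]
  linear_combination (N : ℝ) ^ 2 * hBK

end Supersolution

/-! ### Size and dissipation of the Lyapunov matrix -/

section Bounds

variable {N : ℕ} {a c γ : ℝ}

theorem smul_endProj_mulVec_sub_le (γ : ℝ) (u v : Fin N → ℝ) :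
    (γ • endProj N *ᵥ u - v) ⬝ᵥ (γ • endProj N *ᵥ u - v)
      ≤ 2 * γ ^ 2 * (u ⬝ᵥ u) + 2 * (v ⬝ᵥ v) := by
  have h := sub_dotProduct_self_le (γ • endProj N *ᵥ u) v
  simp only [smul_dotProduct, dotProduct_smul, smul_eq_mul, endProj_form_eq] at h
  have h1 := mul_le_mul_of_nonneg_left (endProj_form_le u) (sq_nonneg γ)
  linarith

theorem driftMatrix_mulVec_le (a c γ : ℝ) (x : Fin N ⊕ Fin N → ℝ) :
    (driftMatrix a c γ N *ᵥ x) ⬝ᵥ (driftMatrix a c γ N *ᵥ x)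
      ≤ (2 + 2 * γ ^ 2 + 2 * (a + 2 * c) ^ 2 + 8 * c ^ 2) * (x ⬝ᵥ x) := by
  rw [dotProduct_sum_elim, driftMatrix_mulVec_inl, driftMatrix_mulVec_inr,
    dotProduct_sum_elim x x]
  have h1 := smul_endProj_mulVec_sub_le γ (x ∘ Sum.inl) (x ∘ Sum.inr)
  have h2 := forceMatrix_mulVec_le a c (x ∘ Sum.inl)
  have h3 := zero_le_dotProduct_self (x ∘ Sum.inl)
  have h4 := mul_nonneg (by positivity : 0 ≤ 2 * γ ^ 2 + 2 * (a + 2 * c) ^ 2 + 8 * c ^ 2)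
    (zero_le_dotProduct_self (x ∘ Sum.inr))
  nlinarith

theorem dotProduct_self_le_driftMatrix (a c γ : ℝ) (x : Fin N ⊕ Fin N → ℝ) :
    x ⬝ᵥ x ≤ (1 + 2 * γ ^ 2) * ((x ∘ Sum.inl) ⬝ᵥ (x ∘ Sum.inl))
      + 2 * (((driftMatrix a c γ N *ᵥ x) ∘ Sum.inl) ⬝ᵥ ((driftMatrix a c γ N *ᵥ x) ∘ Sum.inl)) := by
  have e : x ∘ Sum.inr
      = γ • endProj N *ᵥ (x ∘ Sum.inl) - (driftMatrix a c γ N *ᵥ x) ∘ Sum.inl := by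
    rw [driftMatrix_mulVec_inl, sub_sub_cancel]
  have h := smul_endProj_mulVec_sub_le γ (x ∘ Sum.inl) ((driftMatrix a c γ N *ᵥ x) ∘ Sum.inl)
  rw [← e] at h
  rw [dotProduct_sum_elim]
  linarith

theorem inl_le_energyMatrix_form (ha : 0 < a) (hc : 0 < c) (x : Fin N ⊕ Fin N → ℝ) :
    (x ∘ Sum.inl) ⬝ᵥ (x ∘ Sum.inl) ≤ x ⬝ᵥ energyMatrix a c N *ᵥ x := by
  rw [energyMatrix_form]
  linarith [(forceMatrix_inv_form ha hc (x ∘ Sum.inr)).1]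

theorem energyMatrix_form_le (ha : 0 < a) (hc : 0 < c) (x : Fin N ⊕ Fin N → ℝ) :
    x ⬝ᵥ energyMatrix a c N *ᵥ x ≤ (1 + a⁻¹) * (x ⬝ᵥ x) := by
  rw [energyMatrix_form, dotProduct_sum_elim]
  have h1 := (forceMatrix_inv_form ha hc (x ∘ Sum.inr)).2
  rw [← le_inv_mul_iff₀ ha] at h1
  have h2 := zero_le_dotProduct_self (x ∘ Sum.inr)
  have h3 := mul_nonneg (inv_nonneg.mpr ha.le) (zero_le_dotProduct_self (x ∘ Sum.inl))
  linarith

theorem virial_correction_le (hN : 2 ≤ N) {δ : ℝ} (hδ : 0 ≤ δ) (h u : Fin N → ℝ) :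
    |-((N : ℝ) ^ 2 * (2 * (h ⬝ᵥ virial N *ᵥ u))) + δ * (2 * (h ⬝ᵥ u))|
      ≤ (1 + δ) * (N : ℝ) ^ 3 * (h ⬝ᵥ h + u ⬝ᵥ u) := by
  have hN1 : (1 : ℝ) ≤ (N : ℝ) ^ 3 := one_le_pow₀ (by exact_mod_cast (by omega : 1 ≤ N))
  have h1 := mul_le_mul_of_nonneg_left (virial_form_le hN h u) (sq_nonneg (N : ℝ))
  have h2 := mul_le_mul_of_nonneg_left (virial_form_le hN (-h) u) (sq_nonneg (N : ℝ))
  have h3 := mul_le_mul_of_nonneg_left (two_mul_dotProduct_le h u one_pos) hδ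
  have h4 := mul_le_mul_of_nonneg_left (two_mul_dotProduct_le (-h) u one_pos) hδ
  simp only [neg_dotProduct, dotProduct_neg, neg_neg] at h2 h4
  have h5 : 0 ≤ δ * (h ⬝ᵥ h + u ⬝ᵥ u) :=
    mul_nonneg hδ (add_nonneg (zero_le_dotProduct_self h) (zero_le_dotProduct_self u))
  have h6 := mul_le_mul_of_nonneg_right hN1 h5
  rw [abs_le]
  constructor <;> nlinarith

theorem le_superMatrix_form (ha : 0 < a) (hc : 0 < c) (hN : 2 ≤ N) {κ δ : ℝ} (hδ : 0 ≤ δ)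
    (hκ : 2 + δ ≤ κ) (γ : ℝ) (x : Fin N ⊕ Fin N → ℝ) :
    x ⬝ᵥ x ≤ (2 + 2 * γ ^ 2) * (x ⬝ᵥ superMatrix a c γ κ δ N *ᵥ x) := by
  have hN1 : (1 : ℝ) ≤ (N : ℝ) ^ 3 := one_le_pow₀ (by exact_mod_cast (by omega : 1 ≤ N))
  set M := driftMatrix a c γ N with hM
  set u := x ∘ Sum.inl with hu
  set h := (M *ᵥ x) ∘ Sum.inl with hh
  have hU := zero_le_dotProduct_self u
  have hH := zero_le_dotProduct_self h
  have h1 := inl_le_energyMatrix_form ha hc x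
  have h2 := inl_le_energyMatrix_form ha hc (M *ᵥ x)
  have h3 := (zero_le_dotProduct_self _).trans
    (inl_le_energyMatrix_form ha hc (M *ᵥ M *ᵥ x))
  have h4 := (abs_le.mp (virial_correction_le hN hδ h u)).1
  have h5 : h ⬝ᵥ h + u ⬝ᵥ u ≤ x ⬝ᵥ superMatrix a c γ κ δ N *ᵥ x := by
    rw [superMatrix_form, ← hM, ← hh, ← hu]
    have h6 : κ * (N : ℝ) ^ 3 * (h ⬝ᵥ h + u ⬝ᵥ u) ≤ κ * (N : ℝ) ^ 3
        * (x ⬝ᵥ energyMatrix a c N *ᵥ x + (M *ᵥ x) ⬝ᵥ energyMatrix a c N *ᵥ (M *ᵥ x)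
          + (M *ᵥ M *ᵥ x) ⬝ᵥ energyMatrix a c N *ᵥ (M *ᵥ M *ᵥ x)) :=
      mul_le_mul_of_nonneg_left (by linarith) (mul_nonneg (by linarith) (by linarith))
    have h7 : 1 * (h ⬝ᵥ h + u ⬝ᵥ u) ≤ ((κ - (1 + δ)) * (N : ℝ) ^ 3) * (h ⬝ᵥ h + u ⬝ᵥ u) :=
      mul_le_mul_of_nonneg_right (one_le_mul_of_one_le_of_one_le (by linarith) hN1)
        (by linarith)
    linarith
  have h8 := dotProduct_self_le_driftMatrix a c γ x
  rw [← hM, ← hh, ← hu] at h8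
  have h9 := mul_le_mul_of_nonneg_left h5 (by positivity : 0 ≤ 2 + 2 * γ ^ 2)
  have h10 := mul_nonneg (sq_nonneg γ) hH
  nlinarith

theorem superMatrix_form_le (ha : 0 < a) (hc : 0 < c) (γ : ℝ) {κ δ : ℝ} (hδ : 0 ≤ δ)
    (hκ : 0 ≤ κ) : ∃ C, 0 ≤ C ∧ ∀ N : ℕ, 2 ≤ N → ∀ x : Fin N ⊕ Fin N → ℝ,
      x ⬝ᵥ superMatrix a c γ κ δ N *ᵥ x ≤ C * (N : ℝ) ^ 3 * (x ⬝ᵥ x) := by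
  obtain ⟨μ, hμ⟩ : ∃ μ, μ = 2 + 2 * γ ^ 2 + 2 * (a + 2 * c) ^ 2 + 8 * c ^ 2 := ⟨_, rfl⟩
  have hμ0 : 0 ≤ μ := by rw [hμ]; positivity
  refine ⟨κ * ((1 + a⁻¹) * (1 + μ + μ ^ 2)) + (1 + δ) * (1 + μ), by positivity,
    fun N hN x => ?_⟩
  set M := driftMatrix a c γ N with hM
  have hx := zero_le_dotProduct_self x
  have hMx : (M *ᵥ x) ⬝ᵥ (M *ᵥ x) ≤ μ * (x ⬝ᵥ x) := hμ ▸ driftMatrix_mulVec_le a c γ x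
  have hMMx : (M *ᵥ M *ᵥ x) ⬝ᵥ (M *ᵥ M *ᵥ x) ≤ μ ^ 2 * (x ⬝ᵥ x) := by
    have h1 : (M *ᵥ M *ᵥ x) ⬝ᵥ (M *ᵥ M *ᵥ x) ≤ μ * ((M *ᵥ x) ⬝ᵥ (M *ᵥ x)) :=
      hμ ▸ driftMatrix_mulVec_le a c γ (M *ᵥ x)
    have h2 := mul_le_mul_of_nonneg_left hMx hμ0
    linarith
  have hu : (x ∘ Sum.inl) ⬝ᵥ (x ∘ Sum.inl) ≤ x ⬝ᵥ x := by
    rw [dotProduct_sum_elim x x]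
    linarith [zero_le_dotProduct_self (x ∘ Sum.inr)]
  have hh : ((M *ᵥ x) ∘ Sum.inl) ⬝ᵥ ((M *ᵥ x) ∘ Sum.inl) ≤ μ * (x ⬝ᵥ x) := by
    rw [dotProduct_sum_elim (M *ᵥ x)] at hMx
    linarith [zero_le_dotProduct_self ((M *ᵥ x) ∘ Sum.inr)]
  have hE (y : Fin N ⊕ Fin N → ℝ) {t : ℝ} (hy : y ⬝ᵥ y ≤ t) :
      y ⬝ᵥ energyMatrix a c N *ᵥ y ≤ (1 + a⁻¹) * t :=
    (energyMatrix_form_le ha hc y).trans (mul_le_mul_of_nonneg_left hy (by positivity))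
  have h1 := hE x le_rfl
  have h2 := hE _ hMx
  have h3 := hE _ hMMx
  have h4 := (abs_le.mp (virial_correction_le hN hδ ((M *ᵥ x) ∘ Sum.inl) (x ∘ Sum.inl))).2
  rw [superMatrix_form, ← hM]
  have h5 : κ * (N : ℝ) ^ 3
        * (x ⬝ᵥ energyMatrix a c N *ᵥ x + (M *ᵥ x) ⬝ᵥ energyMatrix a c N *ᵥ (M *ᵥ x)
          + (M *ᵥ M *ᵥ x) ⬝ᵥ energyMatrix a c N *ᵥ (M *ᵥ M *ᵥ x))
      ≤ κ * (N : ℝ) ^ 3 * ((1 + a⁻¹) * (1 + μ + μ ^ 2) * (x ⬝ᵥ x)) :=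
    mul_le_mul_of_nonneg_left (by linarith) (by positivity)
  have h6 : (1 + δ) * (N : ℝ) ^ 3 * (((M *ᵥ x) ∘ Sum.inl) ⬝ᵥ ((M *ᵥ x) ∘ Sum.inl)
        + (x ∘ Sum.inl) ⬝ᵥ (x ∘ Sum.inl))
      ≤ (1 + δ) * (N : ℝ) ^ 3 * ((1 + μ) * (x ⬝ᵥ x)) :=
    mul_le_mul_of_nonneg_left (by linarith) (by positivity)
  linarith

/-- At the end sites the equation of motion expresses the neighbour sum through `x`, `M x` and
`M² x`, so it is controlled by the dissipation of the three energies. -/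
theorem endProj_neighbourSum_le (a γ : ℝ) (hc : 0 < c) {u h g : Fin N → ℝ}
    (hg : g = γ • endProj N *ᵥ h - forceMatrix a c N *ᵥ u) :
    (neighbourSum N *ᵥ u) ⬝ᵥ endProj N *ᵥ (neighbourSum N *ᵥ u)
      ≤ (4 * (a + 2 * c) ^ 2 + 4 + 2 * γ ^ 2) / c ^ 2
        * (u ⬝ᵥ endProj N *ᵥ u + h ⬝ᵥ endProj N *ᵥ h + g ⬝ᵥ endProj N *ᵥ g) := by
  have e : c • neighbourSum N *ᵥ u
      = ((a + 2 * c) • u + g) + (-γ) • endProj N *ᵥ h := by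
    rw [hg, forceMatrix_mulVec]
    module
  have h1 := endProj_form_add_le ((a + 2 * c) • u + g) ((-γ) • endProj N *ᵥ h)
  have h2 := endProj_form_add_le ((a + 2 * c) • u) g
  rw [← e, endProj_form_smul, endProj_form_smul, endProj_form_eq,
    mulVec_mulVec h, endProj_mul_self, neg_sq] at h1
  rw [endProj_form_smul] at h2
  have hu := endProj_form_nonneg u
  have hh := endProj_form_nonneg h
  have hg' := endProj_form_nonneg g
  rw [div_mul_eq_mul_div, le_div_iff₀ (by positivity)]
  have h3 := mul_nonneg (sq_nonneg (a + 2 * c)) (add_nonneg hh hg')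
  have h4 := mul_nonneg (sq_nonneg γ) (add_nonneg hu hg')
  nlinarith

/-- The dissipation estimate. The virial term yields `c N² |D u|²`, which by the Poincaré
inequality dominates `|u|²` up to end-site terms; all end-site terms are of order `N³` times
the dissipation of the energies, which the large factor `κ` absorbs. -/
theorem le_superMatrix_lyapunov_form (ha : 0 < a) (hc : 0 < c) (hγ : 0 < γ) (hN : 2 ≤ N)
    {κ δ : ℝ} (hδ : δ = c / (8 * (a + 4 * c)))
    (hκ : δ * γ + γ / 2 * (1 + (4 * (a + 2 * c) ^ 2 + 4 + 2 * γ ^ 2) / c ^ 2) + 2 * c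
      ≤ κ * (2 * γ))
    (x : Fin N ⊕ Fin N → ℝ) :
    2 * δ * (((driftMatrix a c γ N *ᵥ x) ∘ Sum.inl) ⬝ᵥ ((driftMatrix a c γ N *ᵥ x) ∘ Sum.inl))
        + c / 4 * ((x ∘ Sum.inl) ⬝ᵥ (x ∘ Sum.inl))
      ≤ x ⬝ᵥ (superMatrix a c γ κ δ N * driftMatrix a c γ N
        + (driftMatrix a c γ N)ᵀ * superMatrix a c γ κ δ N) *ᵥ x := by
  have hδ0 : 0 < δ := by rw [hδ]; positivity
  obtain ⟨u, hu⟩ : ∃ u, u = x ∘ Sum.inl := ⟨_, rfl⟩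
  obtain ⟨h, hh⟩ : ∃ h, h = (driftMatrix a c γ N *ᵥ x) ∘ Sum.inl := ⟨_, rfl⟩
  obtain ⟨g, hg⟩ : ∃ g, g = (driftMatrix a c γ N *ᵥ driftMatrix a c γ N *ᵥ x) ∘ Sum.inl :=
    ⟨_, rfl⟩
  have hgu : g = γ • endProj N *ᵥ h - forceMatrix a c N *ᵥ u := by
    rw [hg, driftMatrix_mulVec_inl, driftMatrix_mulVec_inr, ← hh, ← hu]
  rw [superMatrix_lyapunov_form ha hc hN γ κ δ x hu hh hg, ← hu, ← hh]
  have hA := endProj_neighbourSum_le a γ hc hgu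
  have hbu := endProj_form_nonneg u
  have hbh := endProj_form_nonneg h
  have hbg := endProj_form_nonneg g
  have hEu := two_mul_endProj_le (-h) u
  have hEA := two_mul_endProj_le (-h) (neighbourSum N *ᵥ u)
  simp only [mulVec_neg, neg_dotProduct, dotProduct_neg, neg_neg] at hEu hEA
  have hP := dotProduct_self_le_poincare hN u
  have hB := forceMatrix_form_le (a := a) hc u
  generalize u ⬝ᵥ endProj N *ᵥ u = bu at *
  generalize h ⬝ᵥ endProj N *ᵥ h = bh at *
  generalize g ⬝ᵥ endProj N *ᵥ g = bg at *
  generalize neighbourSum N *ᵥ u ⬝ᵥ endProj N *ᵥ neighbourSum N *ᵥ u = bA at *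
  generalize h ⬝ᵥ endProj N *ᵥ neighbourSum N *ᵥ u = hEAu at *
  generalize h ⬝ᵥ endProj N *ᵥ u = hEuu at *
  generalize centralDiff N *ᵥ u ⬝ᵥ centralDiff N *ᵥ u = d at *
  generalize u ⬝ᵥ forceMatrix a c N *ᵥ u = uBu at *
  have hm : 0 ≤ (4 * (a + 2 * c) ^ 2 + 4 + 2 * γ ^ 2) / c ^ 2 := by positivity
  generalize (4 * (a + 2 * c) ^ 2 + 4 + 2 * γ ^ 2) / c ^ 2 = m at *
  generalize u ⬝ᵥ u = U at *
  generalize h ⬝ᵥ h = H at *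
  obtain ⟨b, hb⟩ : ∃ b, b = bu + bh + bg := ⟨_, rfl⟩
  have hb0 : 0 ≤ b := by linarith
  have hN2 : (2 : ℝ) ≤ N := by exact_mod_cast hN
  generalize (N : ℝ) = n at *
  have hn3 : 1 ≤ n ^ 3 := one_le_pow₀ (by linarith)
  have hn : n ≤ n ^ 3 := le_self_pow₀ (by linarith) (by norm_num)
  have hn2 : n ^ 2 * (n - 1) ≤ n ^ 3 := by nlinarith [sq_nonneg n]
  have hn2' : n ^ 2 * (n - 2) ≤ n ^ 3 := by nlinarith [sq_nonneg n]
  have hn0' : 0 ≤ n ^ 2 * (n - 2) := mul_nonneg (sq_nonneg n) (by linarith)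
  have hn0 : 0 ≤ n ^ 2 * (n - 1) := mul_nonneg (sq_nonneg n) (by linarith)
  -- `t1`, `t2`, `t3` bound the end-site terms by multiples of `n ^ 3 * b`, `t4` is the Poincaré
  -- inequality, and in `t5` the choice of `δ` leaves half of the `|u|²` gained there
  have t1 : -(δ * γ * (n ^ 3 * b)) ≤ δ * γ * (2 * hEuu) := by
    have : -(n ^ 3 * b) ≤ 2 * hEuu := by nlinarith
    nlinarith [mul_pos hδ0 hγ]
  have t2 : -(γ / 2 * (1 + m) * (n ^ 3 * b)) ≤ n ^ 2 * (γ * (n - 2) * hEAu) := by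
    have h1 : -((1 + m) * b) ≤ 2 * hEAu := by
      rw [← hb] at hA
      linarith
    have h0 : 0 ≤ (1 + m) * b := by positivity
    have h2 := mul_le_mul_of_nonneg_left h1 hn0'
    have h3 := mul_le_mul_of_nonneg_right hn2' h0
    nlinarith
  have t3 : n ^ 2 * (c * (n - 1) * bu) ≤ c * (n ^ 3 * b) := by
    have h1 : n ^ 2 * (n - 1) * bu ≤ n ^ 3 * b :=
      mul_le_mul hn2 (by linarith) hbu (by linarith)
    nlinarith
  have t4 : c / 2 * U - c * (n ^ 3 * b) ≤ n ^ 2 * (c * d) := by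
    have h1 : n * bu ≤ n ^ 3 * b := mul_le_mul hn (by linarith) hbu (by linarith)
    nlinarith
  have t5 : 2 * δ * uBu ≤ c / 4 * U := by
    have h1 : 2 * δ * ((a + 4 * c) * U) = c / 4 * U := by
      rw [hδ]
      field_simp
      norm_num
    rw [← h1]
    exact mul_le_mul_of_nonneg_left hB (by linarith)
  have t6 := mul_le_mul_of_nonneg_right hκ (mul_nonneg (by linarith : 0 ≤ n ^ 3) hb0)
  rw [← hb]
  linarith

end Bounds

/-! ### Supersolution and conclusion -/

section Solution

variable {a c γ : ℝ}

theorem posDef_of_form {ι : Type*} [Fintype ι] {A : Matrix ι ι ℝ} (hA : Aᵀ = A)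
    (h : ∀ x : ι → ℝ, x ≠ 0 → 0 < x ⬝ᵥ A *ᵥ x) : A.PosDef :=
  .of_dotProduct_mulVec_pos (by rwa [IsHermitian, conjTranspose_eq_transpose_of_trivial])
    fun x hx => by simpa using h x hx

theorem posSemidef_of_form {ι : Type*} [Fintype ι] {A : Matrix ι ι ℝ} (hA : Aᵀ = A)
    (h : ∀ x : ι → ℝ, 0 ≤ x ⬝ᵥ A *ᵥ x) : A.PosSemidef :=
  .of_dotProduct_mulVec_nonneg (by rwa [IsHermitian, conjTranspose_eq_transpose_of_trivial])
    fun x => by simpa using h x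

/-- A Lyapunov matrix of size `O(N³)` whose image dominates the identity, uniformly in `N`. -/
theorem exists_lyapunov_matrix (ha : 0 < a) (hc : 0 < c) (hγ : 0 < γ) :
    ∃ C, 0 ≤ C ∧ ∀ N : ℕ, 2 ≤ N → ∃ P : Matrix (Fin N ⊕ Fin N) (Fin N ⊕ Fin N) ℝ,
      P.PosDef ∧ (∀ x, x ⬝ᵥ P *ᵥ x ≤ C * (N : ℝ) ^ 3 * (x ⬝ᵥ x)) ∧
      ∀ x, x ⬝ᵥ x ≤ x ⬝ᵥ (P * driftMatrix a c γ N + (driftMatrix a c γ N)ᵀ * P) *ᵥ x := by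
  obtain ⟨δ, hδ⟩ : ∃ δ, δ = c / (8 * (a + 4 * c)) := ⟨_, rfl⟩
  have hδ0 : 0 < δ := by rw [hδ]; positivity
  obtain ⟨k, hk⟩ : ∃ k, k = δ * γ
      + γ / 2 * (1 + (4 * (a + 2 * c) ^ 2 + 4 + 2 * γ ^ 2) / c ^ 2) + 2 * c := ⟨_, rfl⟩
  have hk0 : 0 ≤ k := by rw [hk]; positivity
  obtain ⟨κ, hκ⟩ : ∃ κ, κ = k / (2 * γ) + (2 + δ) := ⟨_, rfl⟩
  have hκ1 : 2 + δ ≤ κ := by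
    rw [hκ]
    exact le_add_of_nonneg_left (by positivity)
  have hκ2 : k ≤ κ * (2 * γ) := by
    rw [hκ, add_mul, div_mul_cancel₀ _ (by positivity)]
    exact le_add_of_nonneg_right (by positivity)
  -- `s` rescales the dissipation `2 δ |h|² + (c / 4) |u|²` to dominate `|x|²`
  obtain ⟨s, hs⟩ : ∃ s, s = δ⁻¹ + 4 * (1 + 2 * γ ^ 2) / c := ⟨_, rfl⟩
  have hs0 : 0 < s := by rw [hs]; positivity
  have hs1 : 2 ≤ s * (2 * δ) := by
    have : δ⁻¹ * (2 * δ) = 2 := by field_simp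
    rw [hs, add_mul, this]
    exact le_add_of_nonneg_right (by positivity)
  have hs2 : 1 + 2 * γ ^ 2 ≤ s * (c / 4) := by
    have : 4 * (1 + 2 * γ ^ 2) / c * (c / 4) = 1 + 2 * γ ^ 2 := by field_simp
    rw [hs, add_mul, this]
    exact le_add_of_nonneg_left (by positivity)
  obtain ⟨C, hC0, hC⟩ := superMatrix_form_le ha hc γ hδ0.le (by linarith : 0 ≤ κ)
  refine ⟨s * C, by positivity, fun N hN => ⟨s • superMatrix a c γ κ δ N, ?_, fun x => ?_,
    fun x => ?_⟩⟩
  · refine posDef_of_form (by rw [transpose_smul, transpose_superMatrix]) fun x hx => ?_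
    rw [smul_mulVec, dotProduct_smul, smul_eq_mul]
    refine mul_pos hs0 (pos_of_mul_pos_right (a := 2 + 2 * γ ^ 2) ?_ (by positivity))
    refine lt_of_lt_of_le ?_ (le_superMatrix_form ha hc hN hδ0.le hκ1 γ x)
    exact (zero_le_dotProduct_self x).lt_of_ne' fun h => hx (dotProduct_self_eq_zero.mp h)
  · rw [smul_mulVec, dotProduct_smul, smul_eq_mul]
    have := mul_le_mul_of_nonneg_left (hC N hN x) hs0.le
    linarith
  · rw [smul_mul_assoc, mul_smul_comm, ← smul_add, smul_mulVec, dotProduct_smul, smul_eq_mul]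
    have h1 := mul_le_mul_of_nonneg_left
      (le_superMatrix_lyapunov_form ha hc hγ hN hδ (hk ▸ hκ2) x) hs0.le
    have h2 := dotProduct_self_le_driftMatrix a c γ x
    have h3 := mul_le_mul_of_nonneg_right hs1
      (zero_le_dotProduct_self ((driftMatrix a c γ N *ᵥ x) ∘ Sum.inl))
    have h4 := mul_le_mul_of_nonneg_right hs2 (zero_le_dotProduct_self (x ∘ Sum.inl))
    linarith

theorem posDef_lyapunovRHS {T_L T_R : ℝ} (hTL : 0 < T_L) (hTR : 0 < T_R) (N : ℕ) :
    (lyapunovRHS T_L T_R N).PosDef := by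
  refine posDef_diagonal_iff.mpr fun i => ?_
  rcases i with i | i
  · simp only [Sum.elim_inl]
    split_ifs <;> positivity
  · simp

theorem lyapunovRHS_form_le {T_L T_R : ℝ} (hTL : 0 < T_L) (hTR : 0 < T_R) {N : ℕ}
    (x : Fin N ⊕ Fin N → ℝ) :
    x ⬝ᵥ lyapunovRHS T_L T_R N *ᵥ x ≤ (2 * T_L + 2 * T_R + 1) * (x ⬝ᵥ x) := by
  simp only [lyapunovRHS, dotProduct, mulVec_diagonal, Finset.mul_sum]
  refine Finset.sum_le_sum fun i _ => ?_
  rw [mul_left_comm]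
  refine mul_le_mul_of_nonneg_right ?_ (mul_self_nonneg (x i))
  rcases i with i | i
  · simp only [Sum.elim_inl]
    split_ifs <;> linarith
  · simp only [Sum.elim_inr]
    linarith

/-- A Lyapunov matrix of size `O(N³)` whose image dominates `Π_N`. -/
theorem exists_supersolution {T_L T_R : ℝ} (ha : 0 < a) (hc : 0 < c) (hγ : 0 < γ)
    (hTL : 0 < T_L) (hTR : 0 < T_R) :
    ∃ C, 0 ≤ C ∧ ∀ N : ℕ, 2 ≤ N → ∃ P : Matrix (Fin N ⊕ Fin N) (Fin N ⊕ Fin N) ℝ,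
      P.PosDef ∧ ((C * (N : ℝ) ^ 3) • (1 : Matrix (Fin N ⊕ Fin N) (Fin N ⊕ Fin N) ℝ)
        - P).PosSemidef ∧
      (P * driftMatrix a c γ N + (driftMatrix a c γ N)ᵀ * P
        - lyapunovRHS T_L T_R N).PosSemidef := by
  obtain ⟨C, hC0, hC⟩ := exists_lyapunov_matrix ha hc hγ
  obtain ⟨τ, hτ⟩ : ∃ τ, τ = 2 * T_L + 2 * T_R + 1 := ⟨_, rfl⟩
  have hτ0 : 0 < τ := by rw [hτ]; positivity
  refine ⟨τ * C, by positivity, fun N hN => ?_⟩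
  obtain ⟨P, hP, hPC, hLP⟩ := hC N hN
  have hPt : Pᵀ = P := by
    rw [← conjTranspose_eq_transpose_of_trivial]
    exact hP.isHermitian
  refine ⟨τ • P, hP.smul hτ0, posSemidef_of_form ?_ fun x => ?_, posSemidef_of_form ?_ fun x => ?_⟩
  · simp [hPt]
  · rw [sub_mulVec, smul_mulVec, smul_mulVec, one_mulVec, dotProduct_sub, dotProduct_smul,
      dotProduct_smul, smul_eq_mul, smul_eq_mul]
    have := mul_le_mul_of_nonneg_left (hPC x) hτ0.le
    linarith
  · rw [lyapunovRHS, transpose_sub, diagonal_transpose]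
    simp [hPt, add_comm]
  · rw [sub_mulVec, smul_mul_assoc, mul_smul_comm, ← smul_add, smul_mulVec, dotProduct_sub,
      dotProduct_smul, smul_eq_mul]
    have h1 := mul_le_mul_of_nonneg_left (hLP x) hτ0.le
    have h2 := lyapunovRHS_form_le hTL hTR x
    rw [← hτ] at h2
    linarith

end Solution

end OscillatorChain

theorem proposition1p1 (a c γ T_L T_R : ℝ) (ha : 0 < a) (hc : 0 < c) (hγ : 0 < γ)
    (hTL : 0 < T_L) (hTR : 0 < T_R) :
    (∀ N : ℕ, 2 ≤ N →
      ∃ x y z : Matrix (Fin N) (Fin N) ℝ,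
        (Matrix.fromBlocks x z z.transpose y).IsSymm ∧
        (Matrix.fromBlocks x z z.transpose y).PosDef ∧
        ∀ b : Matrix (Fin N ⊕ Fin N) (Fin N ⊕ Fin N) ℂ,
          OscillatorChain.SolvesLyapunov a c γ T_L T_R N b ↔
            b = (Matrix.fromBlocks x z z.transpose y).map Complex.ofReal) ∧
    (∃ C : ℝ, ∀ N : ℕ, 2 ≤ N →
      ∀ b : Matrix (Fin N ⊕ Fin N) (Fin N ⊕ Fin N) ℂ,
        OscillatorChain.SolvesLyapunov a c γ T_L T_R N b →
          OscillatorChain.matrixNormTwo b ≤ C * (N : ℝ) ^ 3) := by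
  obtain ⟨C, hC0, hC⟩ := OscillatorChain.exists_supersolution ha hc hγ hTL hTR
  refine ⟨fun N hN => ?_, C, fun N hN b hb => ?_⟩
  · obtain ⟨P, hP, -, hLP⟩ := hC N hN
    have hR := OscillatorChain.posDef_lyapunovRHS hTL hTR N
    obtain ⟨b₀, hb₀, huniq⟩ := OscillatorChain.exists_unique_lyapunov hP
      (by simpa using hR.posSemidef_add hLP) hR
    have hsymm : b₀ᵀ = b₀ := by
      rw [← conjTranspose_eq_transpose_of_trivial]
      exact hb₀.isHermitian
    have hblocks : fromBlocks b₀.toBlocks₁₁ b₀.toBlocks₁₂ b₀.toBlocks₁₂ᵀ b₀.toBlocks₂₂ = b₀ := by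
      have h : b₀.toBlocks₁₂ᵀ = b₀.toBlocks₂₁ := by
        ext i j
        exact congrFun (congrFun hsymm (Sum.inr i)) (Sum.inl j)
      rw [h, fromBlocks_toBlocks]
    refine ⟨b₀.toBlocks₁₁, b₀.toBlocks₂₂, b₀.toBlocks₁₂, ?_⟩
    rw [hblocks]
    exact ⟨hsymm, hb₀, huniq⟩
  · obtain ⟨P, hP, hPC, hLP⟩ := hC N hN
    exact OscillatorChain.matrixNormTwo_le_of_supersolution (by positivity) hP
      (OscillatorChain.posDef_lyapunovRHS hTL hTR N) hLP hPC hb
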